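/- Let $X$ be a compact complex manifold. Let $\Omega^\bullet(X)$ be the commutative differential graded algebra (CDGA) of smooth real differential forms on $X$, with the exterior derivative $d$ and the wedge product, and let $\Omega^{p,q}(X)$ be the space of smooth complex forms of type $(p,q)$, so that $d=\partial+\overline\partial$ on complex forms, with $\partial\colon\Omega^{p,q}(X)\to\Omega^{p+1,q}(X)$ and $\overline\partial\colon\Omega^{p,q}(X)\to\Omega^{p,q+1}(X)$. Put $d^c=J^{-1}dJ=-\sqrt{-1}\,(\partial-\overline\partial)$, where $(J\alpha)(v_1,\dots,v_k)=\alpha(Jv_1,\dots,Jv_k)$; this is a real operator. Assume that $X$ satisfies the $\partial\overline\partial$-Lemma, i.e. that for all $p,q$ the map $$H^{p,q}_{BC}(X)=\frac{\ker\partial\cap\ker\overline\partial}{\operatorname{im}\partial\overline\partial}\longrightarrow H^{p,q}_{A}(X)=\frac{\ker\partial\overline\partial}{\operatorname{im}\partial+\operatorname{im}\overline\partial}$$ induced by the identity of $\Omega^{p,q}(X)$ is injective. Then: 1. $X$ is formal: the de Rham algebra $(\Omega^\bullet(X),d)$ is connected to its cohomology algebra $(H^\bullet(X,\mathbb R),0)$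 by a finite chain of quasi-isomorphisms of CDGAs (with arrows in either direction). 2. More precisely, let $H^\bullet_{d^c}(X)=\ker d^c/\operatorname{im}d^c$, with the product and the differential induced by those of $\Omega^\bullet(X)$. In the diagram of CDGAs $$(\Omega^\bullet(X),d)\xleftarrow{\ i\ }(\ker d^c,d)\xrightarrow{\ p\ }(H^\bullet_{d^c}(X),d),$$ where $i$ is the inclusion and $p$ the projection, both $i$ and $p$ are quasi-isomorphisms, and the differential induced by $d$ on $H^\bullet_{d^c}(X)$ is zero. -/

import Mathlib

universe u v

/-- A (graded-)commutative differential graded algebra over `ℝ`, graded by `ℕ`, with differential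
of degree `+1`.  The product of elements of degrees `i` and `j` may be formed in any degree `k`
that comes with a proof of `i + j = k`. -/
structure CDGA where
  obj : ℕ → Type u
  [addCommGroup : ∀ k, AddCommGroup (obj k)]
  [module : ∀ k, Module ℝ (obj k)]
  d : ∀ k, obj k →ₗ[ℝ] obj (k + 1)
  one : obj 0
  mul : ∀ {i j k : ℕ}, i + j = k → obj i →ₗ[ℝ] obj j →ₗ[ℝ] obj k
  d_d : ∀ (k : ℕ) (x : obj k), d (k + 1) (d k x) = 0
  one_mul : ∀ (k : ℕ) (x : obj k), mul (Nat.zero_add k) one x = x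
  mul_one : ∀ (k : ℕ) (x : obj k), mul (Nat.add_zero k) x one = x
  mul_assoc : ∀ {i j l m n k : ℕ} (hm : i + j = m) (hn : j + l = n) (h : m + l = k)
    (h' : i + n = k) (x : obj i) (y : obj j) (z : obj l),
    mul h (mul hm x y) z = mul h' x (mul hn y z)
  mul_comm : ∀ {i j k : ℕ} (h : i + j = k) (h' : j + i = k) (x : obj i) (y : obj j),
    mul h x y = (-1 : ℝ) ^ (i * j) • mul h' y x
  leibniz : ∀ {i j k : ℕ} (h : i + j = k) (h₁ : i + 1 + j = k + 1) (h₂ : i + (j + 1) = k + 1)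
    (x : obj i) (y : obj j),
    d k (mul h x y) = mul h₁ (d i x) y + (-1 : ℝ) ^ i • mul h₂ x (d j y)

namespace CDGA

attribute [instance] CDGA.addCommGroup CDGA.module

/-- A differential `δ` of degree `+1` on a CDGA that is a derivation and anticommutes with `d`. -/
structure SecondDifferential (A : CDGA.{u}) where
  δ : ∀ k, A.obj k →ₗ[ℝ] A.obj (k + 1)
  δ_δ : ∀ (k : ℕ) (x : A.obj k), δ (k + 1) (δ k x) = 0
  anticomm : ∀ (k : ℕ) (x : A.obj k), δ (k + 1) (A.d k x) = -A.d (k + 1) (δ k x)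
  leibniz : ∀ {i j k : ℕ} (h : i + j = k) (h₁ : i + 1 + j = k + 1) (h₂ : i + (j + 1) = k + 1)
    (x : A.obj i) (y : A.obj j),
    δ k (A.mul h x y) = A.mul h₁ (δ i x) y + (-1 : ℝ) ^ i • A.mul h₂ x (δ j y)

/-- The differential `d` itself, as a derivation of square zero anticommuting with `d`. -/
def dSelf (A : CDGA.{u}) : A.SecondDifferential where
  δ := A.d
  δ_δ := A.d_d
  anticomm k x := by simp [A.d_d]
  leibniz h h₁ h₂ x y := A.leibniz h h₁ h₂ x y

namespace SecondDifferential

variable {A : CDGA.{u}} (D : A.SecondDifferential)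

theorem δ_one : D.δ 0 A.one = 0 := by
  have h := D.leibniz (Nat.zero_add 0) (Nat.add_zero 1) (Nat.zero_add 1) A.one A.one
  have h1 := A.mul_one 1 (D.δ 0 A.one)
  have h2 := A.one_mul 1 (D.δ 0 A.one)
  rw [A.one_mul 0] at h
  rw [h1, h2] at h
  simpa using h

/-- The image of `δ` in degree `k`. -/
def image : (k : ℕ) → Submodule ℝ (A.obj k)
  | 0 => ⊥
  | k + 1 => LinearMap.range (D.δ k)

theorem image_le_ker (k : ℕ) : D.image k ≤ LinearMap.ker (D.δ k) := by
  cases k with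
  | zero => exact bot_le
  | succ k =>
    rintro _ ⟨x, rfl⟩
    exact D.δ_δ k x

theorem d_mem_ker {k : ℕ} {x : A.obj k} (hx : x ∈ LinearMap.ker (D.δ k)) :
    A.d k x ∈ LinearMap.ker (D.δ (k + 1)) := by
  rw [LinearMap.mem_ker] at hx ⊢
  rw [D.anticomm, hx, map_zero, neg_zero]

theorem d_mem_image {k : ℕ} {x : A.obj k} (hx : x ∈ D.image k) :
    A.d k x ∈ D.image (k + 1) := by
  cases k with
  | zero =>
    rw [(Submodule.mem_bot ℝ).1 hx, map_zero]
    exact zero_mem _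
  | succ k =>
    obtain ⟨y, rfl⟩ := hx
    exact ⟨-A.d k y, by rw [map_neg, D.anticomm, neg_neg]⟩

theorem mul_mem_ker {i j k : ℕ} (h : i + j = k) {x : A.obj i} {y : A.obj j}
    (hx : x ∈ LinearMap.ker (D.δ i)) (hy : y ∈ LinearMap.ker (D.δ j)) :
    A.mul h x y ∈ LinearMap.ker (D.δ k) := by
  rw [LinearMap.mem_ker] at hx hy ⊢
  rw [D.leibniz h (by omega) (by omega), hx, hy]
  simp

theorem mul_mem_image {i j k : ℕ} (h : i + j = k) {x : A.obj i} {y : A.obj j}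
    (hx : x ∈ LinearMap.ker (D.δ i)) (hy : y ∈ D.image j) :
    A.mul h x y ∈ D.image k := by
  cases j with
  | zero =>
    rw [(Submodule.mem_bot ℝ).1 hy, map_zero]
    exact zero_mem _
  | succ j =>
    obtain ⟨z, rfl⟩ := hy
    obtain rfl : i + j + 1 = k := by omega
    rw [LinearMap.mem_ker] at hx
    refine ⟨(-1 : ℝ) ^ i • A.mul rfl x z, ?_⟩
    rw [map_smul, D.leibniz rfl (by omega) h, hx, map_zero, LinearMap.zero_apply, zero_add,
      smul_smul, ← mul_pow]
    simp

theorem mul_mem_image' {i j k : ℕ} (h : i + j = k) {x : A.obj i} {y : A.obj j}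
    (hx : x ∈ D.image i) (hy : y ∈ LinearMap.ker (D.δ j)) :
    A.mul h x y ∈ D.image k := by
  rw [A.mul_comm h (by omega)]
  exact Submodule.smul_mem _ _ (D.mul_mem_image _ hy hx)

/-- The sub-CDGA `(ker δ, d)` of `(A, d)`. -/
def kernel : CDGA.{u} where
  obj k := LinearMap.ker (D.δ k)
  d k := (A.d k).restrict fun _ hx => D.d_mem_ker hx
  one := ⟨A.one, D.δ_one⟩
  mul {i j k} h := LinearMap.mk₂ ℝ
    (fun (x : LinearMap.ker (D.δ i)) (y : LinearMap.ker (D.δ j)) =>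
      (⟨A.mul h x y, D.mul_mem_ker h x.2 y.2⟩ : LinearMap.ker (D.δ k)))
    (fun _ _ _ => Subtype.ext (by simp)) (fun _ _ _ => Subtype.ext (by simp))
    (fun _ _ _ => Subtype.ext (by simp)) (fun _ _ _ => Subtype.ext (by simp))
  d_d k x := Subtype.ext (A.d_d k x)
  one_mul k x := Subtype.ext (A.one_mul k x)
  mul_one k x := Subtype.ext (A.mul_one k x)
  mul_assoc hm hn h h' x y z := Subtype.ext (A.mul_assoc hm hn h h' x y z)
  mul_comm h h' x y := Subtype.ext (A.mul_comm h h' x y)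
  leibniz h h₁ h₂ x y := Subtype.ext (A.leibniz h h₁ h₂ x y)

/-- The image of `δ` as a subspace of `ker δ`. -/
def imageInKernel (k : ℕ) : Submodule ℝ (D.kernel.obj k) :=
  (D.image k).comap (LinearMap.ker (D.δ k)).subtype

/-- The product on `ker δ / im δ` induced by the product on `ker δ`. -/
def cohomologyMul {i j k : ℕ} (h : i + j = k) :
    (D.kernel.obj i ⧸ D.imageInKernel i) →ₗ[ℝ] (D.kernel.obj j ⧸ D.imageInKernel j) →ₗ[ℝ]
      (D.kernel.obj k ⧸ D.imageInKernel k) :=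
  (D.imageInKernel i).liftQ
    ((D.imageInKernel j).liftQ ((D.kernel.mul h).compr₂ (D.imageInKernel k).mkQ).flip
      (fun y hy => by
        ext x
        exact (Submodule.Quotient.mk_eq_zero _).2 (D.mul_mem_image h x.2 hy))).flip
    (fun x hx => by
      ext y
      exact (Submodule.Quotient.mk_eq_zero _).2 (D.mul_mem_image' h hx y.2))

/-- The CDGA `H_δ(A) = ker δ / im δ`, with the differential and the product induced by those
of `A`. -/
def cohomology : CDGA.{u} where
  obj k := D.kernel.obj k ⧸ D.imageInKernel k
  d k := (D.imageInKernel k).mapQ (D.imageInKernel (k + 1)) (D.kernel.d k)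
    fun _ hx => D.d_mem_image hx
  one := (D.imageInKernel 0).mkQ D.kernel.one
  mul h := D.cohomologyMul h
  d_d k x := by
    induction x using Submodule.Quotient.induction_on with | _ x
    exact congrArg (Submodule.mkQ _) (D.kernel.d_d k x)
  one_mul k x := by
    induction x using Submodule.Quotient.induction_on with | _ x
    exact congrArg (Submodule.mkQ _) (D.kernel.one_mul k x)
  mul_one k x := by
    induction x using Submodule.Quotient.induction_on with | _ x
    exact congrArg (Submodule.mkQ _) (D.kernel.mul_one k x)
  mul_assoc hm hn h h' x y z := by
    induction x using Submodule.Quotient.induction_on with | _ x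
    induction y using Submodule.Quotient.induction_on with | _ y
    induction z using Submodule.Quotient.induction_on with | _ z
    exact congrArg (Submodule.mkQ _) (D.kernel.mul_assoc hm hn h h' x y z)
  mul_comm h h' x y := by
    induction x using Submodule.Quotient.induction_on with | _ x
    induction y using Submodule.Quotient.induction_on with | _ y
    exact congrArg (Submodule.mkQ _) (D.kernel.mul_comm h h' x y)
  leibniz h h₁ h₂ x y := by
    induction x using Submodule.Quotient.induction_on with | _ x
    induction y using Submodule.Quotient.induction_on with | _ y
    exact congrArg (Submodule.mkQ _) (D.kernel.leibniz h h₁ h₂ x y)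

end SecondDifferential

/-- The cohomology algebra `H(A) = ker d / im d`, a CDGA whose (induced) differential is zero. -/
def cohomology (A : CDGA.{u}) : CDGA.{u} := A.dSelf.cohomology

theorem cohomology_d (A : CDGA.{u}) (k : ℕ) : A.cohomology.d k = 0 := by
  refine LinearMap.ext fun x => ?_
  induction x using Submodule.Quotient.induction_on with | _ x
  refine congrArg (Submodule.mkQ _) (?_ : A.dSelf.kernel.d k x = 0)
  exact Subtype.ext x.2

/-- Morphisms of CDGAs. -/
structure Hom (A B : CDGA.{u}) where
  toFun : ∀ k, A.obj k →ₗ[ℝ] B.obj k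
  map_d : ∀ (k : ℕ) (x : A.obj k), toFun (k + 1) (A.d k x) = B.d k (toFun k x)
  map_one : toFun 0 A.one = B.one
  map_mul : ∀ {i j k : ℕ} (h : i + j = k) (x : A.obj i) (y : A.obj j),
    toFun k (A.mul h x y) = B.mul h (toFun i x) (toFun j y)

namespace Hom

variable {A B : CDGA.{u}} (f : Hom A B)

/-- The map on cocycles induced by a morphism. -/
def mapCocycles (k : ℕ) : LinearMap.ker (A.d k) →ₗ[ℝ] LinearMap.ker (B.d k) :=
  (f.toFun k).restrict fun x hx => by
    rw [LinearMap.mem_ker] at hx ⊢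
    rw [← f.map_d, hx, map_zero]

/-- The map `Hᵏ(A) → Hᵏ(B)` induced by a morphism. -/
def mapCohomology (k : ℕ) : A.cohomology.obj k →ₗ[ℝ] B.cohomology.obj k :=
  (A.dSelf.imageInKernel k).mapQ (B.dSelf.imageInKernel k) (f.mapCocycles k) (by
    intro x hx
    change f.toFun k x.1 ∈ B.dSelf.image k
    have hx' : x.1 ∈ A.dSelf.image k := hx
    generalize x.1 = z at hx'
    cases k with
    | zero =>
      rw [(Submodule.mem_bot ℝ).1 hx', map_zero]
      exact zero_mem _
    | succ k =>
      obtain ⟨y, rfl⟩ := hx'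
      exact ⟨f.toFun k y, (f.map_d k y).symm⟩)

/-- A quasi-isomorphism is a morphism that induces isomorphisms in cohomology. -/
def IsQuasiIso : Prop := ∀ k, Function.Bijective (f.mapCohomology k)

end Hom

/-- The inclusion `(ker δ, d) → (A, d)`. -/
def SecondDifferential.incl {A : CDGA.{u}} (D : A.SecondDifferential) : Hom D.kernel A where
  toFun k := (LinearMap.ker (D.δ k)).subtype
  map_d _ _ := rfl
  map_one := rfl
  map_mul _ _ _ := rfl

/-- The projection `(ker δ, d) → (H_δ(A), d)`. -/
def SecondDifferential.proj {A : CDGA.{u}} (D : A.SecondDifferential) :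
    Hom D.kernel D.cohomology where
  toFun k := (D.imageInKernel k).mkQ
  map_d _ _ := rfl
  map_one := rfl
  map_mul _ _ _ := rfl

/-- Two CDGAs are weakly equivalent if they are connected by a finite chain (of arrows pointing
in either direction) of quasi-isomorphisms of CDGAs. -/
def WeaklyEquivalent : CDGA.{u} → CDGA.{u} → Prop :=
  Relation.EqvGen fun A B => ∃ f : Hom A B, f.IsQuasiIso

/-- A CDGA is formal if it is connected to its cohomology algebra, with zero differential, by a
chain of quasi-isomorphisms of CDGAs. -/
def IsFormal (A : CDGA.{u}) : Prop := WeaklyEquivalent A A.cohomology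

end CDGA

namespace AlternatingForms

open scoped Nat

set_option linter.unusedSectionVars false

variable {E : Type u} [NormedAddCommGroup E] [NormedSpace ℝ E]

/-- `Fin i ⊕ Fin j ≃ Fin k` for `i + j = k`: first the block of length `i`, then that of
length `j`. -/
def blocks {i j k : ℕ} (h : i + j = k) : Fin i ⊕ Fin j ≃ Fin k :=
  finSumFinEquiv.trans (finCongr h)

/-- The tensor product `(f ⊗ g)(v₁, …, vₖ) = f(v₁, …, vᵢ) g(vᵢ₊₁, …, vₖ)`. -/
noncomputable def tensor {i j k : ℕ} (h : i + j = k)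
    (f : ContinuousMultilinearMap ℝ (fun _ : Fin i => E) ℝ)
    (g : ContinuousMultilinearMap ℝ (fun _ : Fin j => E) ℝ) :
    ContinuousMultilinearMap ℝ (fun _ : Fin k => E) ℝ where
  toMultilinearMap := (LinearMap.mul' ℝ ℝ).compMultilinearMap
    ((f.toMultilinearMap.domCoprod g.toMultilinearMap).domDomCongr (blocks h))
  cont := by
    have : Continuous fun v : Fin k → E =>
        f (fun a => v (blocks h (Sum.inl a))) * g (fun a => v (blocks h (Sum.inr a))) := by
      fun_prop
    exact this

theorem tensor_apply {i j k : ℕ} (h : i + j = k)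
    (f : ContinuousMultilinearMap ℝ (fun _ : Fin i => E) ℝ)
    (g : ContinuousMultilinearMap ℝ (fun _ : Fin j => E) ℝ) (v : Fin k → E) :
    tensor h f g v = f (v ∘ blocks h ∘ Sum.inl) * g (v ∘ blocks h ∘ Sum.inr) := rfl

/-- The wedge product of alternating forms,
`(f ∧ g)(v₁, …, vₖ) = 1 / (i! j!) ∑_σ sign σ f(v_σ(1), …, v_σ(i)) g(v_σ(i+1), …, v_σ(k))`. -/
noncomputable def wedge {i j k : ℕ} (h : i + j = k) (f : E [⋀^Fin i]→L[ℝ] ℝ)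
    (g : E [⋀^Fin j]→L[ℝ] ℝ) : E [⋀^Fin k]→L[ℝ] ℝ :=
  ((i ! : ℝ) * (j ! : ℝ))⁻¹ • ContinuousMultilinearMap.alternatization
    (tensor h f.toContinuousMultilinearMap g.toContinuousMultilinearMap)

/-- The sum over all permutations, with signs, of a function of `k` vectors. -/
noncomputable def altSum {k : ℕ} (S : (Fin k → E) → ℝ) (v : Fin k → E) : ℝ :=
  ∑ σ : Equiv.Perm (Fin k), ((Equiv.Perm.sign σ : ℤ) : ℝ) * S (v ∘ σ)

/-- The tensor product for arbitrary functions of several vectors. -/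
def tens {i j k : ℕ} (h : i + j = k) (f : (Fin i → E) → ℝ) (g : (Fin j → E) → ℝ)
    (v : Fin k → E) : ℝ :=
  f (v ∘ blocks h ∘ Sum.inl) * g (v ∘ blocks h ∘ Sum.inr)

theorem wedge_apply {i j k : ℕ} (h : i + j = k) (f : E [⋀^Fin i]→L[ℝ] ℝ)
    (g : E [⋀^Fin j]→L[ℝ] ℝ) (v : Fin k → E) :
    wedge h f g v = ((i ! : ℝ) * (j ! : ℝ))⁻¹ * altSum (tens h f g) v := by
  simp only [wedge, ContinuousAlternatingMap.smul_apply, smul_eq_mul,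
    ContinuousMultilinearMap.alternatization_apply_apply, altSum, tensor_apply, tens]
  congr 1
  refine Finset.sum_congr rfl fun σ _ => ?_
  rw [Units.smul_def, zsmul_eq_mul]
  rfl

theorem sign_mul_sign {k : ℕ} (τ : Equiv.Perm (Fin k)) :
    ((Equiv.Perm.sign τ : ℤ) : ℝ) * ((Equiv.Perm.sign τ : ℤ) : ℝ) = 1 := by
  rw [← Int.cast_mul, ← Units.val_mul, Int.units_mul_self]
  simp

theorem altSum_comp {k : ℕ} (S : (Fin k → E) → ℝ) (τ : Equiv.Perm (Fin k)) :
    altSum (fun v => S (v ∘ τ)) = fun v => ((Equiv.Perm.sign τ : ℤ) : ℝ) * altSum S v := by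
  funext v
  rw [altSum, altSum, Finset.mul_sum]
  refine Fintype.sum_equiv (Equiv.mulRight τ) _ _ fun σ => ?_
  rw [Equiv.coe_mulRight, Equiv.Perm.sign_mul]
  push_cast
  rw [← mul_assoc, mul_comm ((Equiv.Perm.sign σ : ℤ) : ℝ) ((Equiv.Perm.sign τ : ℤ) : ℝ),
    ← mul_assoc, sign_mul_sign, one_mul]
  rfl

theorem altSum_smul {k : ℕ} (c : ℝ) (S : (Fin k → E) → ℝ) :
    altSum (fun v => c * S v) = fun v => c * altSum S v := by
  funext v
  simp only [altSum, Finset.mul_sum]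
  exact Finset.sum_congr rfl fun σ _ => by ring

theorem altSum_sum {k : ℕ} {ι : Type*} [Fintype ι] (S : ι → (Fin k → E) → ℝ) :
    altSum (fun v => ∑ a, S a v) = fun v => ∑ a, altSum (S a) v := by
  funext v
  simp only [altSum, Finset.mul_sum]
  exact Finset.sum_comm

/-- Alternating a function that is itself an alternating sum over a group of permutations. -/
theorem altSum_altSum {k : ℕ} {ι : Type*} [Fintype ι] (S : (Fin k → E) → ℝ)
    (ρ : ι → Equiv.Perm (Fin k)) (c : ι → ℝ)
    (hc : ∀ a, c a = ((Equiv.Perm.sign (ρ a) : ℤ) : ℝ)) :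
    altSum (fun v => ∑ a, c a * S (v ∘ ρ a)) = fun v => (Fintype.card ι : ℝ) * altSum S v := by
  rw [altSum_sum (fun a v => c a * S (v ∘ ρ a))]
  funext v
  simp only [altSum_smul _ (fun v => S (v ∘ ρ _)), altSum_comp, hc]
  simp only [← mul_assoc, sign_mul_sign, one_mul]
  simp

theorem altSum_self {k : ℕ} (f : E [⋀^Fin k]→L[ℝ] ℝ) :
    altSum f = fun v => (k ! : ℝ) * f v := by
  funext v
  have : ∀ σ : Equiv.Perm (Fin k), ((Equiv.Perm.sign σ : ℤ) : ℝ) * f (v ∘ σ) = f v := fun σ => by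
    have h := f.toAlternatingMap.map_perm v σ
    have h' : f (v ∘ σ) = ((Equiv.Perm.sign σ : ℤ) : ℝ) * f v := by
      rw [Units.smul_def, zsmul_eq_mul] at h
      exact h
    rw [h', ← mul_assoc, sign_mul_sign, one_mul]
  simp [altSum, this, Fintype.card_perm]

theorem altSum_tens_altSum_left {i j k : ℕ} (h : i + j = k) (f : (Fin i → E) → ℝ)
    (g : (Fin j → E) → ℝ) :
    altSum (tens h (altSum f) g) = fun v => (i ! : ℝ) * altSum (tens h f g) v := by
  have := altSum_altSum (tens h f g)
    (fun σ : Equiv.Perm (Fin i) => (blocks h).permCongr (Equiv.sumCongr σ (Equiv.refl _)))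
    (fun σ => ((Equiv.Perm.sign σ : ℤ) : ℝ)) (fun σ => by
      rw [Equiv.Perm.sign_permCongr]
      have := Equiv.Perm.sign_sumCongr σ (1 : Equiv.Perm (Fin j))
      simp only [Equiv.Perm.sign_one, mul_one] at this
      rw [← this]
      rfl)
  rw [Fintype.card_perm, Fintype.card_fin] at this
  rw [← this]
  congr 1
  funext v
  simp only [tens, altSum, Finset.sum_mul]
  refine Finset.sum_congr rfl fun σ _ => ?_
  rw [mul_assoc]
  congr 3 <;> · funext a; simp

theorem altSum_tens_altSum_right {i j k : ℕ} (h : i + j = k) (f : (Fin i → E) → ℝ)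
    (g : (Fin j → E) → ℝ) :
    altSum (tens h f (altSum g)) = fun v => (j ! : ℝ) * altSum (tens h f g) v := by
  have := altSum_altSum (tens h f g)
    (fun σ : Equiv.Perm (Fin j) => (blocks h).permCongr (Equiv.sumCongr (Equiv.refl _) σ))
    (fun σ => ((Equiv.Perm.sign σ : ℤ) : ℝ)) (fun σ => by
      rw [Equiv.Perm.sign_permCongr]
      have := Equiv.Perm.sign_sumCongr (1 : Equiv.Perm (Fin i)) σ
      simp only [Equiv.Perm.sign_one, one_mul] at this
      rw [← this]
      rfl)
  rw [Fintype.card_perm, Fintype.card_fin] at this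
  rw [← this]
  congr 1
  funext v
  simp only [tens, altSum, Finset.mul_sum]
  refine Finset.sum_congr rfl fun σ _ => ?_
  rw [mul_left_comm]
  congr 3 <;> · funext a; simp

theorem tens_smul_left {i j k : ℕ} (h : i + j = k) (c : ℝ) (f : (Fin i → E) → ℝ)
    (g : (Fin j → E) → ℝ) :
    tens h (fun v => c * f v) g = fun v => c * tens h f g v := by
  funext v
  simp [tens, mul_assoc]

theorem tens_smul_right {i j k : ℕ} (h : i + j = k) (c : ℝ) (f : (Fin i → E) → ℝ)
    (g : (Fin j → E) → ℝ) :
    tens h f (fun v => c * g v) = fun v => c * tens h f g v := by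
  funext v
  simp [tens, mul_left_comm]

theorem coe_wedge {i j k : ℕ} (h : i + j = k) (f : E [⋀^Fin i]→L[ℝ] ℝ)
    (g : E [⋀^Fin j]→L[ℝ] ℝ) :
    (wedge h f g : (Fin k → E) → ℝ) =
      fun v => ((i ! : ℝ) * (j ! : ℝ))⁻¹ * altSum (tens h f g) v :=
  funext fun v => wedge_apply h f g v

theorem wedge_assoc {i j l m n k : ℕ} (hm : i + j = m) (hn : j + l = n) (h : m + l = k)
    (h' : i + n = k) (f : E [⋀^Fin i]→L[ℝ] ℝ) (g : E [⋀^Fin j]→L[ℝ] ℝ)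
    (e : E [⋀^Fin l]→L[ℝ] ℝ) :
    wedge h (wedge hm f g) e = wedge h' f (wedge hn g e) := by
  ext v
  rw [wedge_apply, wedge_apply, coe_wedge, coe_wedge, tens_smul_left, tens_smul_right,
    altSum_smul, altSum_smul, altSum_tens_altSum_left, altSum_tens_altSum_right]
  have : tens h (tens hm f g) e = tens h' f (tens hn g e) := by
    funext v
    simp only [tens, mul_assoc]
    subst hm hn h
    congr 3
    · funext a
      simp only [Function.comp_apply]
      congr 1
      ext
      simp [blocks, Nat.add_assoc]
  rw [this]
  have h1 := Nat.factorial_ne_zero m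
  have h2 := Nat.factorial_ne_zero n
  have h3 := Nat.factorial_ne_zero i
  have h4 := Nat.factorial_ne_zero j
  have h5 := Nat.factorial_ne_zero l
  field_simp

/-- The sign of the permutation exchanging the block of length `i` and that of length `j`. -/
theorem sign_blocks_comm {i j k : ℕ} (h : i + j = k) (h' : j + i = k) :
    Equiv.Perm.sign (((blocks h).symm.trans (Equiv.sumComm _ _)).trans (blocks h')) =
      (-1) ^ (i * j) := by
  have key : ((blocks h).symm.trans (Equiv.sumComm _ _)).trans (blocks h') =
      (finRotate k) ^ j := by
    subst h
    rcases Nat.eq_zero_or_pos (i + j) with h0 | h0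
    · ext a
      exact absurd a.2 (by omega)
    · obtain ⟨n, hn⟩ : ∃ n, i + j = n + 1 := ⟨i + j - 1, by omega⟩
      have hr : ∀ (m : ℕ) (a : Fin (i + j)),
          ((((finRotate (i + j)) ^ m) a : Fin (i + j)) : ℕ) = ((a : ℕ) + m) % (i + j) := by
        intro m a
        induction m with
        | zero => simp [Nat.mod_eq_of_lt a.2]
        | succ m ih =>
          have hs : ∀ b : Fin (i + j), ((finRotate (i + j) b : Fin (i + j)) : ℕ) =
              ((b : ℕ) + 1) % (i + j) := by
            rw [hn]
            intro b
            rw [finRotate_apply, Fin.val_add]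
            simp
          rw [pow_succ', Equiv.Perm.mul_apply, hs, ih]
          simp [Nat.add_assoc]
      refine Equiv.ext fun a => Fin.ext ?_
      rw [hr]
      obtain ⟨b, rfl⟩ := (blocks (rfl : i + j = i + j)).surjective a
      rcases b with b | b
      · simp [blocks]
        rw [Nat.mod_eq_of_lt (by omega)]
      · simp [blocks]
        rw [show i + (b : ℕ) + j = b + (i + j) by omega, Nat.add_mod_right,
          Nat.mod_eq_of_lt (by omega)]
  rw [key, map_pow, sign_finRotate, ← pow_mul]
  subst h
  rcases Nat.even_or_odd j with hj | hj
  · rw [(hj.mul_left _).neg_one_pow, (hj.mul_left _).neg_one_pow]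
  · obtain ⟨r, rfl⟩ := hj
    rw [show i + (2 * r + 1) - 1 = i + 2 * r by omega]
    rw [show (i + 2 * r) * (2 * r + 1) = i * (2 * r + 1) + 2 * (r * (2 * r + 1)) by ring,
      pow_add, pow_mul (-1 : ℤˣ) 2]
    simp

theorem wedge_comm {i j k : ℕ} (h : i + j = k) (h' : j + i = k) (f : E [⋀^Fin i]→L[ℝ] ℝ)
    (g : E [⋀^Fin j]→L[ℝ] ℝ) :
    wedge h f g = (-1 : ℝ) ^ (i * j) • wedge h' g f := by
  ext v
  rw [ContinuousAlternatingMap.smul_apply, smul_eq_mul, wedge_apply, wedge_apply]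
  have h1 : tens h f g = fun v => tens h' g f
      (v ∘ (((blocks h').symm.trans (Equiv.sumComm _ _)).trans (blocks h))) := by
    funext v
    simp only [tens]
    rw [mul_comm]
    congr 2 <;> · funext a; simp
  rw [h1, altSum_comp, sign_blocks_comm]
  push_cast
  rw [Nat.mul_comm j i]
  ring

theorem one_wedge {k : ℕ} (f : E [⋀^Fin k]→L[ℝ] ℝ) :
    wedge (Nat.zero_add k) (ContinuousAlternatingMap.constOfIsEmpty ℝ E (Fin 0) 1) f = f := by
  ext v
  have : tens (Nat.zero_add k) (ContinuousAlternatingMap.constOfIsEmpty ℝ E (Fin 0) 1) f = f := by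
    funext v
    simp only [tens, ContinuousAlternatingMap.constOfIsEmpty_apply, one_mul]
    congr 1
    funext a
    simp only [Function.comp_apply]
    congr 1
    ext
    simp [blocks]
  rw [wedge_apply, this, altSum_self]
  have := Nat.factorial_ne_zero k
  simp
  field_simp

theorem wedge_one {k : ℕ} (f : E [⋀^Fin k]→L[ℝ] ℝ) :
    wedge (Nat.add_zero k) f (ContinuousAlternatingMap.constOfIsEmpty ℝ E (Fin 0) 1) = f := by
  rw [wedge_comm _ (Nat.zero_add k), one_wedge]
  simp

theorem wedge_compContinuousLinearMap {E' : Type v} [NormedAddCommGroup E'] [NormedSpace ℝ E']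
    {i j k : ℕ} (h : i + j = k)
    (f : E [⋀^Fin i]→L[ℝ] ℝ) (g : E [⋀^Fin j]→L[ℝ] ℝ) (A : E' →L[ℝ] E) :
    (wedge h f g).compContinuousLinearMap A =
      wedge h (f.compContinuousLinearMap A) (g.compContinuousLinearMap A) := by
  ext v
  rw [ContinuousAlternatingMap.compContinuousLinearMap_apply, wedge_apply, wedge_apply]
  rfl

theorem norm_wedge_le {i j k : ℕ} (h : i + j = k) (f : E [⋀^Fin i]→L[ℝ] ℝ)
    (g : E [⋀^Fin j]→L[ℝ] ℝ) :
    ‖wedge h f g‖ ≤ (((i ! : ℝ) * (j ! : ℝ))⁻¹ * (k ! : ℝ)) * ‖f‖ * ‖g‖ := by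
  refine ContinuousAlternatingMap.opNorm_le_bound _ (by positivity) fun v => ?_
  rw [wedge_apply, norm_mul, Real.norm_of_nonneg (by positivity), mul_assoc, mul_assoc, mul_assoc]
  refine mul_le_mul_of_nonneg_left ?_ (by positivity)
  calc ‖altSum (tens h f g) v‖
      ≤ ∑ σ : Equiv.Perm (Fin k), ‖f‖ * (‖g‖ * ∏ a, ‖v a‖) := by
        refine norm_sum_le_of_le _ fun σ _ => ?_
        have hs : ‖((Equiv.Perm.sign σ : ℤ) : ℝ)‖ = 1 := by
          rcases Int.units_eq_one_or (Equiv.Perm.sign σ) with h | h <;> simp [h]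
        rw [norm_mul, hs, one_mul, tens, norm_mul]
        have hprod : ∏ a, ‖v a‖ = (∏ a : Fin i, ‖(v ∘ σ) (blocks h (Sum.inl a))‖) *
            ∏ a : Fin j, ‖(v ∘ σ) (blocks h (Sum.inr a))‖ := by
          rw [← Fintype.prod_sum_type (fun s => ‖(v ∘ σ) (blocks h s)‖)]
          rw [Equiv.prod_comp (blocks h) (fun a => ‖(v ∘ σ) a‖)]
          exact (Equiv.prod_comp σ (fun a => ‖v a‖)).symm
        rw [hprod]
        calc _ ≤ (‖f‖ * ∏ a : Fin i, ‖(v ∘ σ) (blocks h (Sum.inl a))‖) *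
              (‖g‖ * ∏ a : Fin j, ‖(v ∘ σ) (blocks h (Sum.inr a))‖) :=
              mul_le_mul (f.le_opNorm _) (g.le_opNorm _) (norm_nonneg _) (by positivity)
          _ = _ := by ring
    _ = _ := by simp [Fintype.card_perm]

theorem wedge_add_left {i j k : ℕ} (h : i + j = k) (f f' : E [⋀^Fin i]→L[ℝ] ℝ)
    (g : E [⋀^Fin j]→L[ℝ] ℝ) : wedge h (f + f') g = wedge h f g + wedge h f' g := by
  ext v
  simp only [ContinuousAlternatingMap.add_apply, wedge_apply, altSum, tens, ← mul_add,
    ← Finset.sum_add_distrib, add_mul]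

theorem wedge_smul_left {i j k : ℕ} (h : i + j = k) (c : ℝ) (f : E [⋀^Fin i]→L[ℝ] ℝ)
    (g : E [⋀^Fin j]→L[ℝ] ℝ) : wedge h (c • f) g = c • wedge h f g := by
  ext v
  simp only [ContinuousAlternatingMap.smul_apply, smul_eq_mul, wedge_apply]
  have : tens h (c • f : E [⋀^Fin i]→L[ℝ] ℝ) g = fun v => c * tens h f g v :=
    tens_smul_left h c f g
  rw [this, altSum_smul]
  ring

theorem wedge_add_right {i j k : ℕ} (h : i + j = k) (f : E [⋀^Fin i]→L[ℝ] ℝ)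
    (g g' : E [⋀^Fin j]→L[ℝ] ℝ) : wedge h f (g + g') = wedge h f g + wedge h f g' := by
  rw [wedge_comm h (by omega), wedge_add_left, smul_add, ← wedge_comm, ← wedge_comm]

theorem wedge_smul_right {i j k : ℕ} (h : i + j = k) (c : ℝ) (f : E [⋀^Fin i]→L[ℝ] ℝ)
    (g : E [⋀^Fin j]→L[ℝ] ℝ) : wedge h f (c • g) = c • wedge h f g := by
  rw [wedge_comm h (by omega), wedge_smul_left, smul_comm, ← wedge_comm]

/-- The wedge product as a continuous bilinear map. -/
noncomputable def wedgeCLM {i j k : ℕ} (h : i + j = k) :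
    (E [⋀^Fin i]→L[ℝ] ℝ) →L[ℝ] (E [⋀^Fin j]→L[ℝ] ℝ) →L[ℝ] (E [⋀^Fin k]→L[ℝ] ℝ) :=
  LinearMap.mkContinuous₂
    (LinearMap.mk₂ ℝ (wedge h) (wedge_add_left h) (wedge_smul_left h) (wedge_add_right h)
      (fun c f g => wedge_smul_right h c f g)) _ (norm_wedge_le h)

theorem wedgeCLM_apply {i j k : ℕ} (h : i + j = k) (f : E [⋀^Fin i]→L[ℝ] ℝ)
    (g : E [⋀^Fin j]→L[ℝ] ℝ) : wedgeCLM h f g = wedge h f g := rfl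

theorem contDiffOn_wedge {i j k : ℕ} (h : i + j = k) {r : WithTop ℕ∞}
    {f : E → E [⋀^Fin i]→L[ℝ] ℝ} {g : E → E [⋀^Fin j]→L[ℝ] ℝ} {s : Set E}
    (hf : ContDiffOn ℝ r f s) (hg : ContDiffOn ℝ r g s) :
    ContDiffOn ℝ r (fun z => wedge h (f z) (g z)) s := by
  have h1 : ContDiff ℝ r (wedgeCLM (E := E) h) := ContinuousLinearMap.contDiff _
  have h2 : ContDiffOn ℝ r (fun z => wedgeCLM (E := E) h (f z)) s := h1.comp_contDiffOn hf
  exact h2.clm_apply hg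

theorem altSum_uncurry {n : ℕ} (L : E →L[ℝ] E [⋀^Fin n]→L[ℝ] ℝ) :
    altSum (fun v : Fin (n + 1) → E => L (v 0) (Fin.tail v)) =
      fun v => (n ! : ℝ) * ContinuousAlternatingMap.alternatizeUncurryFin L v := by
  have h1 : (ContinuousAlternatingMap.alternatizeUncurryFin L : (Fin (n + 1) → E) → ℝ) =
      fun v => ∑ p : Fin (n + 1), (-1 : ℝ) ^ (p : ℕ) *
        (fun v : Fin (n + 1) → E => L (v 0) (Fin.tail v)) (v ∘ p.cycleRange.symm) := by
    funext v
    rw [ContinuousAlternatingMap.alternatizeUncurryFin_apply]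
    refine Finset.sum_congr rfl fun p _ => ?_
    rw [zsmul_eq_mul]
    push_cast
    congr 2
    · simp
    · funext a
      simp [Fin.removeNth, Fin.tail]
  have h2 := altSum_self (ContinuousAlternatingMap.alternatizeUncurryFin L)
  have h4 := altSum_altSum (fun v : Fin (n + 1) → E => L (v 0) (Fin.tail v))
    (fun p : Fin (n + 1) => p.cycleRange.symm) (fun p => (-1 : ℝ) ^ (p : ℕ)) (fun p => by
    rw [Equiv.Perm.sign_symm, Fin.sign_cycleRange]; simp)
  rw [← h1] at h4
  replace h2 := h4.symm.trans h2
  funext v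
  have h3 := congrFun h2 v
  simp only [Fintype.card_fin, Nat.factorial_succ] at h3
  push_cast at h3
  have : ((n : ℝ) + 1) ≠ 0 := by positivity
  rw [mul_assoc] at h3
  exact mul_left_cancel₀ this h3

theorem alternatizeUncurryFin_wedge_left {i j k : ℕ} (h : i + j = k) (h₁ : i + 1 + j = k + 1)
    (L : E →L[ℝ] E [⋀^Fin i]→L[ℝ] ℝ) (g : E [⋀^Fin j]→L[ℝ] ℝ) :
    ContinuousAlternatingMap.alternatizeUncurryFin (((wedgeCLM h).flip g).comp L) =
      wedge h₁ (ContinuousAlternatingMap.alternatizeUncurryFin L) g := by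
  have fk : (k ! : ℝ) ≠ 0 := by exact_mod_cast Nat.factorial_ne_zero k
  have fi : (i ! : ℝ) ≠ 0 := by exact_mod_cast Nat.factorial_ne_zero i
  have fi' : ((i + 1)! : ℝ) ≠ 0 := by exact_mod_cast Nat.factorial_ne_zero (i + 1)
  have fj : (j ! : ℝ) ≠ 0 := by exact_mod_cast Nat.factorial_ne_zero j
  set T : (Fin (i + 1) → E) → ℝ := fun v => L (v 0) (Fin.tail v) with hT
  have hL : (ContinuousAlternatingMap.alternatizeUncurryFin L : (Fin (i + 1) → E) → ℝ) =
      fun v => ((i ! : ℝ))⁻¹ * altSum T v := by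
    rw [hT, altSum_uncurry]
    funext v
    field_simp
  ext v
  rw [wedge_apply, hL, tens_smul_left, altSum_smul, altSum_tens_altSum_left]
  have h2 := congrFun (altSum_uncurry (((wedgeCLM h).flip g).comp L)) v
  have h3 : (fun v : Fin (k + 1) → E => (((wedgeCLM h).flip g).comp L) (v 0) (Fin.tail v)) =
      fun v => ((i ! : ℝ) * (j ! : ℝ))⁻¹ * ∑ σ : Equiv.Perm (Fin k),
        ((Equiv.Perm.sign σ : ℤ) : ℝ) *
          tens h₁ T g (v ∘ (Equiv.Perm.decomposeFin.symm (0, σ))) := by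
    funext v
    change wedge h (L (v 0)) g (Fin.tail v) = _
    rw [wedge_apply, altSum]
    congr 1
    refine Finset.sum_congr rfl fun σ _ => ?_
    congr 1
    have e0 : blocks h₁ (Sum.inl 0) = 0 := by ext; simp [blocks]
    have e1 : ∀ a : Fin i, blocks h₁ (Sum.inl a.succ) = (blocks h (Sum.inl a)).succ := by
      intro a; ext; simp [blocks]
    have e2 : ∀ a : Fin j, blocks h₁ (Sum.inr a) = (blocks h (Sum.inr a)).succ := by
      intro a; ext; simp [blocks]; omega
    have t0 : ((v ∘ Equiv.Perm.decomposeFin.symm (0, σ)) ∘ blocks h₁ ∘ Sum.inl) 0 = v 0 := by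
      simp [e0]
    have t1 : Fin.tail ((v ∘ Equiv.Perm.decomposeFin.symm (0, σ)) ∘ blocks h₁ ∘ Sum.inl) =
        (Fin.tail v ∘ σ) ∘ blocks h ∘ Sum.inl := by
      funext a; simp [Fin.tail, e1]
    have t2 : (v ∘ Equiv.Perm.decomposeFin.symm (0, σ)) ∘ blocks h₁ ∘ Sum.inr =
        (Fin.tail v ∘ σ) ∘ blocks h ∘ Sum.inr := by
      funext a; simp [Fin.tail, e2]
    simp only [tens, hT, t1, t2, t0]
  rw [h3, altSum_smul, altSum_altSum _ _ _ (fun σ => by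
    rw [Equiv.Perm.decomposeFin.symm_sign]; simp), Fintype.card_perm, Fintype.card_fin] at h2
  have h4 : ContinuousAlternatingMap.alternatizeUncurryFin (((wedgeCLM h).flip g).comp L) v =
      ((i ! : ℝ) * (j ! : ℝ))⁻¹ * altSum (tens h₁ T g) v := by
    refine mul_left_cancel₀ fk ?_
    rw [← h2]
    ring
  rw [h4]
  field_simp

theorem alternatizeUncurryFin_wedge_right {i j k : ℕ} (h : i + j = k) (h₂ : i + (j + 1) = k + 1)
    (f : E [⋀^Fin i]→L[ℝ] ℝ) (M : E →L[ℝ] E [⋀^Fin j]→L[ℝ] ℝ) :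
    ContinuousAlternatingMap.alternatizeUncurryFin ((wedgeCLM h f).comp M) =
      (-1 : ℝ) ^ i • wedge h₂ f (ContinuousAlternatingMap.alternatizeUncurryFin M) := by
  have h' : j + i = k := by omega
  have h₁ : j + 1 + i = k + 1 := by omega
  have : (wedgeCLM h f).comp M = (-1 : ℝ) ^ (i * j) • ((wedgeCLM h').flip f).comp M := by
    ext1 x
    exact wedge_comm h h' f (M x)
  rw [this, ContinuousAlternatingMap.alternatizeUncurryFin_smul,
    alternatizeUncurryFin_wedge_left h' h₁, wedge_comm h₁ h₂, smul_smul, ← pow_add]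
  have : i * j + (j + 1) * i = i + 2 * (i * j) := by ring
  rw [this, pow_add, pow_mul]
  simp

/-- The Leibniz rule for the exterior derivative of differential forms on a normed space. -/
theorem extDeriv_wedge {i j k : ℕ} (h : i + j = k) (h₁ : i + 1 + j = k + 1)
    (h₂ : i + (j + 1) = k + 1) {ω : E → E [⋀^Fin i]→L[ℝ] ℝ} {η : E → E [⋀^Fin j]→L[ℝ] ℝ} {x : E}
    (hω : DifferentiableAt ℝ ω x) (hη : DifferentiableAt ℝ η x) :
    extDeriv (fun y => wedge h (ω y) (η y)) x =
      wedge h₁ (extDeriv ω x) (η x) + (-1 : ℝ) ^ i • wedge h₂ (ω x) (extDeriv η x) := by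
  have : fderiv ℝ (fun y => wedge h (ω y) (η y)) x =
      ((wedgeCLM h).flip (η x)).comp (fderiv ℝ ω x) +
        (wedgeCLM h (ω x)).comp (fderiv ℝ η x) := by
    have := (wedgeCLM h).hasFDerivAt_of_bilinear hω.hasFDerivAt hη.hasFDerivAt
    have h2 := this.fderiv
    rw [add_comm]
    exact h2
  rw [extDeriv, this, ContinuousAlternatingMap.alternatizeUncurryFin_add,
    alternatizeUncurryFin_wedge_left h h₁, alternatizeUncurryFin_wedge_right h h₂]
  rfl

end AlternatingForms

namespace DifferentialForms

open scoped Manifold ContDiff Topology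
open AlternatingForms

set_option linter.unusedSectionVars false

section Real

variable (E : Type u) [NormedAddCommGroup E] [NormedSpace ℝ E]
variable (M : Type v) [TopologicalSpace M] [ChartedSpace E M]
variable (𝕜 : Type) [NormedField 𝕜] [NormedAlgebra ℝ 𝕜]

/-- Not necessarily continuous `𝕜`-valued differential forms of degree `k`: families of
alternating `k`-linear forms on the tangent spaces. -/
abbrev RoughForm (k : ℕ) : Type (max u v) :=
  ∀ x : M, TangentSpace 𝓘(ℝ, E) x [⋀^Fin k]→L[ℝ] 𝕜

variable {E M 𝕜}

/-- The expression of a form in a chart `e`: its pullback under `e.symm`. -/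
noncomputable def inChart {k : ℕ} (e : OpenPartialHomeomorph M E) (α : RoughForm E M 𝕜 k) :
    E → E [⋀^Fin k]→L[ℝ] 𝕜 := fun y =>
  (α (e.symm y)).compContinuousLinearMap (mfderiv 𝓘(ℝ, E) 𝓘(ℝ, E) e.symm y)

variable (E M 𝕜)

/-- The smooth forms, as a subspace of the space of all forms: a form is smooth if its expressions
in all charts are. -/
noncomputable def smoothForms (k : ℕ) : Submodule 𝕜 (RoughForm E M 𝕜 k) where
  carrier := {α | ∀ e ∈ atlas E M, ContDiffOn ℝ ∞ (inChart e α) e.target}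
  add_mem' hα hβ e he := (hα e he).add (hβ e he)
  zero_mem' _ _ := contDiffOn_const (c := 0)
  smul_mem' c _ hα e he := (hα e he).const_smul c

/-- The space `Ωᵏ(M; 𝕜)` of smooth `𝕜`-valued differential forms of degree `k`. -/
def Form (k : ℕ) : Type (max u v) := smoothForms E M 𝕜 k

noncomputable instance instAddCommGroupForm (k : ℕ) : AddCommGroup (Form E M 𝕜 k) :=
  inferInstanceAs (AddCommGroup (smoothForms E M 𝕜 k))

noncomputable instance instModuleForm (k : ℕ) : Module 𝕜 (Form E M 𝕜 k) :=
  inferInstanceAs (Module 𝕜 (smoothForms E M 𝕜 k))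

variable {E M 𝕜}

theorem comp_congr_point {k : ℕ} (α : RoughForm E M 𝕜 k) {p q : M} (h : p = q) {A B : E →L[ℝ] E}
    (hAB : A = B) :
    (α p : E [⋀^Fin k]→L[ℝ] 𝕜).compContinuousLinearMap A =
      (α q : E [⋀^Fin k]→L[ℝ] 𝕜).compContinuousLinearMap B := by
  subst h hAB
  rfl

/-- The exterior derivative of a form (with junk values where it is not differentiable): at `x`
it is computed in the preferred chart at `x`. -/
noncomputable def roughD {k : ℕ} (α : RoughForm E M 𝕜 k) : RoughForm E M 𝕜 (k + 1) := fun x =>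
  (extDeriv (inChart (chartAt E x) α) (chartAt E x x)).compContinuousLinearMap
    (mfderiv 𝓘(ℝ, E) 𝓘(ℝ, E) (chartAt E x) x)

section

variable [IsManifold 𝓘(ℝ, E) ∞ M]

theorem mdiff_chart {e : OpenPartialHomeomorph M E} (he : e ∈ atlas E M) :
    e.MDifferentiable 𝓘(ℝ, E) 𝓘(ℝ, E) :=
  haveI : IsManifold 𝓘(ℝ, E) 1 M := IsManifold.of_le (n := ∞) (by norm_num)
  mdifferentiable_of_mem_atlas he

theorem contDiffOn_transition {e e' : OpenPartialHomeomorph M E} (he : e ∈ atlas E M)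
    (he' : e' ∈ atlas E M) : ContDiffOn ℝ ∞ (e' ∘ e.symm) (e.symm.trans e').source := by
  have := (contDiffGroupoid ∞ 𝓘(ℝ, E)).compatible he he'
  exact contMDiffOn_iff_contDiffOn.1 (contMDiffOn_of_mem_contDiffGroupoid this)

/-- The mixed chain rule used below to compare two charts. -/
theorem mfderiv_symm_eq {e e' : OpenPartialHomeomorph M E} (he : e ∈ atlas E M)
    (he' : e' ∈ atlas E M) {z : E} (hz : z ∈ e.target) (hz' : e.symm z ∈ e'.source) :
    (mfderiv 𝓘(ℝ, E) 𝓘(ℝ, E) e.symm z : E →L[ℝ] E) =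
      (mfderiv 𝓘(ℝ, E) 𝓘(ℝ, E) e'.symm (e' (e.symm z)) : E →L[ℝ] E).comp
        (fderiv ℝ (e' ∘ e.symm : E → E) z) := by
  have h1 : e.symm =ᶠ[𝓝 z] e'.symm ∘ (e' ∘ e.symm) := by
    have := (e.symm.trans e').open_source.mem_nhds (show z ∈ (e.symm.trans e').source by
      simp [hz, hz'])
    filter_upwards [this] with y hy
    simp only [OpenPartialHomeomorph.trans_source, OpenPartialHomeomorph.symm_source,
      Set.mem_inter_iff, Set.mem_preimage] at hy
    simp [e'.left_inv hy.2]
  have h2 : MDifferentiableAt 𝓘(ℝ, E) 𝓘(ℝ, E) (e' ∘ e.symm) z :=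
    ((mdiff_chart he').mdifferentiableAt hz').comp z ((mdiff_chart he).mdifferentiableAt_symm hz)
  have h3 := mfderiv_comp z ((mdiff_chart he').mdifferentiableAt_symm (e'.map_source hz')) h2
  have h4 : (mfderiv 𝓘(ℝ, E) 𝓘(ℝ, E) (e' ∘ e.symm : E → E) z : E →L[ℝ] E) =
      fderiv ℝ (e' ∘ e.symm : E → E) z := mfderiv_eq_fderiv
  exact h1.mfderiv_eq.trans (h3.trans (congrArg (fun B : E →L[ℝ] E =>
    (mfderiv 𝓘(ℝ, E) 𝓘(ℝ, E) e'.symm (e' (e.symm z)) : E →L[ℝ] E).comp B) h4))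

theorem inChart_eq {k : ℕ} (α : RoughForm E M 𝕜 k) {e e' : OpenPartialHomeomorph M E}
    (he : e ∈ atlas E M) (he' : e' ∈ atlas E M) {z : E} (hz : z ∈ e.target)
    (hz' : e.symm z ∈ e'.source) :
    inChart e α z = (inChart e' α (e' (e.symm z))).compContinuousLinearMap
      (fderiv ℝ (e' ∘ e.symm : E → E) z) :=
  comp_congr_point α (e'.left_inv hz').symm (mfderiv_symm_eq he he' hz hz')

theorem mfderiv_chart_comp {e e' : OpenPartialHomeomorph M E} (he : e ∈ atlas E M)
    (he' : e' ∈ atlas E M) {z : E} (hz : z ∈ e.target) (hz' : e.symm z ∈ e'.source) :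
    (mfderiv 𝓘(ℝ, E) 𝓘(ℝ, E) e' (e.symm z) : E →L[ℝ] E).comp
      (mfderiv 𝓘(ℝ, E) 𝓘(ℝ, E) e.symm z : E →L[ℝ] E) = fderiv ℝ (e' ∘ e.symm : E → E) z := by
  rw [← mfderiv_eq_fderiv]
  exact (mfderiv_comp z ((mdiff_chart he').mdifferentiableAt hz')
    ((mdiff_chart he).mdifferentiableAt_symm hz)).symm

theorem contDiffAt_inChart {k : ℕ} (α : Form E M 𝕜 k) {e : OpenPartialHomeomorph M E}
    (he : e ∈ atlas E M) {z : E} (hz : z ∈ e.target) : ContDiffAt ℝ ∞ (inChart e α.1) z :=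
  (α.2 e he).contDiffAt (e.open_target.mem_nhds hz)

theorem differentiableAt_inChart {k : ℕ} (α : Form E M 𝕜 k) {e : OpenPartialHomeomorph M E}
    (he : e ∈ atlas E M) {z : E} (hz : z ∈ e.target) : DifferentiableAt ℝ (inChart e α.1) z :=
  (contDiffAt_inChart α he hz).differentiableAt (by simp)

/-- In every chart, the exterior derivative is the usual one. -/
theorem inChart_roughD {k : ℕ} (α : Form E M 𝕜 k) {e : OpenPartialHomeomorph M E}
    (he : e ∈ atlas E M) {z : E} (hz : z ∈ e.target) :
    inChart e (roughD α.1) z = extDeriv (inChart e α.1) z := by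
  set e' := chartAt E (e.symm z) with he'd
  have he' : e' ∈ atlas E M := chart_mem_atlas E _
  have hz' : e.symm z ∈ e'.source := mem_chart_source E _
  have hs : (e.symm.trans e').source ∈ 𝓝 z :=
    (e.symm.trans e').open_source.mem_nhds (by simp [hz, hz'])
  have h1 : inChart e α.1 =ᶠ[𝓝 z] fun y =>
      (inChart e' α.1 ((e' ∘ e.symm) y)).compContinuousLinearMap
        (fderiv ℝ (e' ∘ e.symm : E → E) y) := by
    filter_upwards [hs] with y hy
    simp only [OpenPartialHomeomorph.trans_source, OpenPartialHomeomorph.symm_source,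
      Set.mem_inter_iff, Set.mem_preimage] at hy
    exact inChart_eq α.1 he he' hy.1 hy.2
  rw [h1.extDeriv_eq, extDeriv_pullback (r := ∞) (f := (e' ∘ e.symm : E → E))
      (differentiableAt_inChart α he' (e'.map_source hz'))
    ((contDiffOn_transition he he').contDiffAt hs) (by simp; norm_cast),
    ← mfderiv_chart_comp he he' hz hz']
  rfl

theorem contDiffOn_extDeriv {k : ℕ} {f : E → E [⋀^Fin k]→L[ℝ] 𝕜} {s : Set E} (hs : IsOpen s)
    (hf : ContDiffOn ℝ ∞ f s) : ContDiffOn ℝ ∞ (extDeriv f) s :=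
  (ContinuousAlternatingMap.alternatizeUncurryFinCLM ℝ E 𝕜).contDiff.comp_contDiffOn
    (hf.fderiv_of_isOpen hs (by simp))

theorem roughD_mem {k : ℕ} (α : Form E M 𝕜 k) : roughD α.1 ∈ smoothForms E M 𝕜 (k + 1) := fun _ he =>
  (contDiffOn_extDeriv (OpenPartialHomeomorph.open_target _) (α.2 _ he)).congr
    fun _ hz => inChart_roughD α he hz

/-- Forms agreeing in all charts are equal. -/
theorem ext_inChart {k : ℕ} {α β : RoughForm E M 𝕜 k}
    (h : ∀ e ∈ atlas E M, ∀ z ∈ e.target, inChart e α z = inChart e β z) : α = β := by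
  funext x
  have h1 := h (chartAt E x) (chart_mem_atlas E x) _ (mem_chart_target E x)
  have hx := (chartAt E x).left_inv (mem_chart_source E x)
  have h2 : ∀ θ : RoughForm E M 𝕜 k, (inChart (chartAt E x) θ
      (chartAt E x x)).compContinuousLinearMap (mfderiv 𝓘(ℝ, E) 𝓘(ℝ, E) (chartAt E x) x) =
        θ x := by
    intro θ
    have h3 := (mdiff_chart (chart_mem_atlas E x)).symm_comp_deriv (mem_chart_source E x)
    have h4 := comp_congr_point θ hx h3
    refine Eq.trans ?_ (h4.trans ?_)
    · rfl
    · ext v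
      rfl
  rw [← h2 α, ← h2 β, h1]

variable (E M 𝕜)

/-- The exterior derivative `d : Ωᵏ(M; 𝕜) → Ωᵏ⁺¹(M; 𝕜)`. -/
noncomputable def d (k : ℕ) : Form E M 𝕜 k →ₗ[𝕜] Form E M 𝕜 (k + 1) where
  toFun α := (⟨roughD α.1, roughD_mem α⟩ : smoothForms E M 𝕜 (k + 1))
  map_add' α β := by
    refine Subtype.ext (ext_inChart fun e he z hz => ?_)
    rw [inChart_roughD (α + β) he hz]
    refine (extDeriv_add (differentiableAt_inChart α he hz) (differentiableAt_inChart β he hz)).trans ?_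
    rw [← inChart_roughD α he hz, ← inChart_roughD β he hz]
    rfl
  map_smul' c α := by
    refine Subtype.ext (ext_inChart fun e he z hz => ?_)
    rw [inChart_roughD (c • α) he hz]
    have h1 : extDeriv (c • inChart e α.1) z = c • extDeriv (inChart e α.1) z := by
      rw [extDeriv, fderiv_const_smul (differentiableAt_inChart α he hz),
        ContinuousAlternatingMap.alternatizeUncurryFin_smul]
      rfl
    refine Eq.trans h1 ?_
    rw [← inChart_roughD α he hz]
    rfl

variable {E M 𝕜}

theorem inChart_d {k : ℕ} (α : Form E M 𝕜 k) {e : OpenPartialHomeomorph M E}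
    (he : e ∈ atlas E M) {z : E} (hz : z ∈ e.target) :
    inChart e (d E M 𝕜 k α).1 z = extDeriv (inChart e α.1) z :=
  inChart_roughD α he hz

theorem inChart_d_eventuallyEq {k : ℕ} (α : Form E M 𝕜 k) {e : OpenPartialHomeomorph M E}
    (he : e ∈ atlas E M) {z : E} (hz : z ∈ e.target) :
    inChart e (d E M 𝕜 k α).1 =ᶠ[𝓝 z] extDeriv (inChart e α.1) := by
  filter_upwards [e.open_target.mem_nhds hz] with y hy using inChart_d α he hy

theorem d_d (k : ℕ) (α : Form E M 𝕜 k) : d E M 𝕜 (k + 1) (d E M 𝕜 k α) = 0 := by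
  refine Subtype.ext (ext_inChart fun e he z hz => ?_)
  rw [inChart_d _ he hz, (inChart_d_eventuallyEq α he hz).extDeriv_eq,
    extDeriv_extDeriv_apply (contDiffAt_inChart α he hz) (by simp; norm_cast)]
  rfl

/-- The constant function `1`, as a form of degree zero. -/
noncomputable def one : Form E M ℝ 0 :=
  (⟨fun _ => ContinuousAlternatingMap.constOfIsEmpty ℝ _ (Fin 0) 1, fun _ _ =>
    contDiffOn_const (c := ContinuousAlternatingMap.constOfIsEmpty ℝ E (Fin 0) (1 : ℝ))⟩ :
      smoothForms E M ℝ 0)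

/-- The wedge product `Ωⁱ(M) × Ωʲ(M) → Ωᵏ(M)` of real forms, `i + j = k`, taken pointwise. -/
noncomputable def mul {i j k : ℕ} (h : i + j = k) :
    Form E M ℝ i →ₗ[ℝ] Form E M ℝ j →ₗ[ℝ] Form E M ℝ k :=
  LinearMap.mk₂ ℝ
    (fun α β => (⟨fun x => wedge (E := E) h (α.1 x) (β.1 x), fun e he =>
      (contDiffOn_wedge h (α.2 e he) (β.2 e he)).congr fun _ _ =>
        wedge_compContinuousLinearMap (E := E) (E' := E) h _ _ _⟩ : smoothForms E M ℝ k))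
    (fun _ _ _ => Subtype.ext (funext fun _ => wedge_add_left (E := E) h _ _ _))
    (fun _ _ _ => Subtype.ext (funext fun _ => wedge_smul_left (E := E) h _ _ _))
    (fun _ _ _ => Subtype.ext (funext fun _ => wedge_add_right (E := E) h _ _ _))
    (fun _ _ _ => Subtype.ext (funext fun _ => wedge_smul_right (E := E) h _ _ _))

theorem inChart_mul {i j k : ℕ} (h : i + j = k) (α : Form E M ℝ i) (β : Form E M ℝ j)
    (e : OpenPartialHomeomorph M E) (z : E) :
    inChart e (mul h α β).1 z = wedge h (inChart e α.1 z) (inChart e β.1 z) :=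
  wedge_compContinuousLinearMap (E := E) (E' := E) h _ _ _

theorem leibniz {i j k : ℕ} (h : i + j = k) (h₁ : i + 1 + j = k + 1) (h₂ : i + (j + 1) = k + 1)
    (α : Form E M ℝ i) (β : Form E M ℝ j) :
    d E M ℝ k (mul h α β) =
      mul h₁ (d E M ℝ i α) β + (-1 : ℝ) ^ i • mul h₂ α (d E M ℝ j β) := by
  refine Subtype.ext (ext_inChart fun e he z hz => ?_)
  rw [inChart_d _ he hz]
  have h3 : inChart e (mul h α β).1 = fun y => wedge h (inChart e α.1 y) (inChart e β.1 y) :=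
    funext fun y => inChart_mul h α β e y
  rw [h3, extDeriv_wedge h h₁ h₂ (differentiableAt_inChart α he hz) (differentiableAt_inChart β he hz),
    ← inChart_d α he hz, ← inChart_d β he hz, ← inChart_mul, ← inChart_mul]
  rfl

variable (E M)

/-- The de Rham algebra `(Ω(M), d)` of smooth real differential forms on `M`. -/
noncomputable def deRham : CDGA.{max u v} where
  obj k := Form E M ℝ k
  d := d E M ℝ
  one := one
  mul := mul
  d_d := d_d
  one_mul _ _ := Subtype.ext (funext fun _ => one_wedge (E := E) _)
  mul_one _ _ := Subtype.ext (funext fun _ => wedge_one (E := E) _)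
  mul_assoc hm hn h h' _ _ _ :=
    Subtype.ext (funext fun _ => wedge_assoc (E := E) hm hn h h' _ _ _)
  mul_comm h h' _ _ := Subtype.ext (funext fun _ => wedge_comm (E := E) h h' _ _)
  leibniz := leibniz

end

end Real

section Complex

variable (E : Type u) [NormedAddCommGroup E] [NormedSpace ℂ E]
variable (X : Type v) [TopologicalSpace X] [ChartedSpace E X]
variable (𝕜 : Type) [NormedField 𝕜] [NormedAlgebra ℝ 𝕜]

/-- Multiplication by a complex number, as a real linear map. -/
noncomputable def mulC (c : ℂ) : E →L[ℝ] E := (c • ContinuousLinearMap.id ℂ E).restrictScalars ℝ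

theorem mulC_apply (c : ℂ) (v : E) : mulC E c v = c • v := rfl

variable {E X 𝕜}

/-- The pullback of a form under multiplication by `c : ℂ` on the (complex) tangent spaces:
`(c^*α)(v₁, …, vₖ) = α(c v₁, …, c vₖ)`. -/
noncomputable def roughPullC {k : ℕ} (c : ℂ) (α : RoughForm E X 𝕜 k) : RoughForm E X 𝕜 k :=
  fun x => (α x : E [⋀^Fin k]→L[ℝ] 𝕜).compContinuousLinearMap (mulC E c)

section

variable [IsManifold 𝓘(ℂ, E) ω X]

/-- A complex manifold is a smooth real manifold. -/
instance instIsManifoldReal : IsManifold 𝓘(ℝ, E) ∞ X := by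
  refine isManifold_of_contDiffOn _ _ _ fun e e' he he' => ?_
  have h1 := contMDiffOn_iff_contDiffOn.1 (contMDiffOn_of_mem_contDiffGroupoid
    ((contDiffGroupoid ω 𝓘(ℂ, E)).compatible he he'))
  have h2 := (h1.restrict_scalars ℝ).of_le (m := ∞) le_top
  simpa using h2

theorem differentiableAt_transition {e e' : OpenPartialHomeomorph X E} (he : e ∈ atlas E X)
    (he' : e' ∈ atlas E X) {z : E} (hz : z ∈ e.target) (hz' : e.symm z ∈ e'.source) :
    DifferentiableAt ℂ (e' ∘ e.symm : E → E) z := by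
  have h1 := contMDiffOn_iff_contDiffOn.1 (contMDiffOn_of_mem_contDiffGroupoid
    ((contDiffGroupoid ω 𝓘(ℂ, E)).compatible he he'))
  exact (h1.contDiffAt ((e.symm.trans e').open_source.mem_nhds (by simp [hz, hz']))).differentiableAt
    (by simp)

theorem fderiv_eq_of_within_univ (f : E → E) (A : E →L[ℝ] E) (z : E)
    (h : HasFDerivWithinAt f A Set.univ z) : fderiv ℝ f z = A :=
  (hasFDerivWithinAt_univ.1 h).fderiv

theorem mfderiv_symm_comp_mulC {e : OpenPartialHomeomorph X E} (he : e ∈ atlas E X) {z : E}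
    (hz : z ∈ e.target) (c : ℂ) :
    (mulC E c).comp (mfderiv 𝓘(ℝ, E) 𝓘(ℝ, E) e.symm z : E →L[ℝ] E) =
      (mfderiv 𝓘(ℝ, E) 𝓘(ℝ, E) e.symm z : E →L[ℝ] E).comp (mulC E c) := by
  have h1 : (mfderiv 𝓘(ℝ, E) 𝓘(ℝ, E) e.symm z : E →L[ℝ] E) =
      fderiv ℝ (chartAt E (e.symm z) ∘ e.symm : E → E) z := by
    have h := ((mdiff_chart he).mdifferentiableAt_symm hz).hasMFDerivAt.2
    rw [ModelWithCorners.range_eq_univ] at h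
    exact (fderiv_eq_of_within_univ _ _ _ h).symm
  rw [h1, (differentiableAt_transition he (chart_mem_atlas E _) hz
    (mem_chart_source E _)).fderiv_restrictScalars ℝ]
  refine ContinuousLinearMap.ext fun (v : E) => ?_
  exact (map_smul (fderiv ℂ (chartAt E (e.symm z) ∘ e.symm : E → E) z) c v).symm

theorem inChart_roughPullC {k : ℕ} (c : ℂ) (α : RoughForm E X 𝕜 k)
    {e : OpenPartialHomeomorph X E} (he : e ∈ atlas E X) {z : E} (hz : z ∈ e.target) :
    inChart e (roughPullC c α) z = (inChart e α z).compContinuousLinearMap (mulC E c) :=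
  congrArg (fun A : E →L[ℝ] E =>
    (α (e.symm z) : E [⋀^Fin k]→L[ℝ] 𝕜).compContinuousLinearMap A)
    (mfderiv_symm_comp_mulC he hz c)

variable (E X 𝕜)

/-- The pullback under multiplication by `c : ℂ`, as a linear map on smooth forms. -/
noncomputable def pullC (k : ℕ) (c : ℂ) : Form E X 𝕜 k →ₗ[𝕜] Form E X 𝕜 k where
  toFun α := (⟨roughPullC c α.1, fun e he =>
    ((ContinuousAlternatingMap.compContinuousLinearMapCLM (F := 𝕜) (ι := Fin k)
      (mulC E c)).contDiff.comp_contDiffOn (α.2 e he)).congr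
        fun _ hz => inChart_roughPullC c α.1 he hz⟩ : smoothForms E X 𝕜 k)
  map_add' _ _ := rfl
  map_smul' _ _ := rfl

variable {E X 𝕜}

theorem inChart_pullC {k : ℕ} (c : ℂ) (α : Form E X 𝕜 k)
    {e : OpenPartialHomeomorph X E} (he : e ∈ atlas E X) {z : E} (hz : z ∈ e.target) :
    inChart e (pullC E X 𝕜 k c α).1 z = (inChart e α.1 z).compContinuousLinearMap (mulC E c) :=
  inChart_roughPullC c α.1 he hz

theorem pullC_pullC {k : ℕ} (a b : ℂ) (α : Form E X 𝕜 k) :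
    pullC E X 𝕜 k a (pullC E X 𝕜 k b α) = pullC E X 𝕜 k (b * a) α := by
  refine Subtype.ext (funext fun x => ContinuousAlternatingMap.ext fun (v : Fin k → E) => ?_)
  change (α.1 x : E [⋀^Fin k]→L[ℝ] 𝕜) (fun i => b • a • v i) =
    (α.1 x : E [⋀^Fin k]→L[ℝ] 𝕜) (fun i => (b * a) • v i)
  simp only [smul_smul]

theorem pullC_one {k : ℕ} (α : Form E X 𝕜 k) : pullC E X 𝕜 k 1 α = α := by
  refine Subtype.ext (funext fun x => ContinuousAlternatingMap.ext fun (v : Fin k → E) => ?_)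
  change (α.1 x : E [⋀^Fin k]→L[ℝ] 𝕜) (fun i => (1 : ℂ) • v i) =
    (α.1 x : E [⋀^Fin k]→L[ℝ] 𝕜) v
  simp only [one_smul]

theorem pullC_mul {i j k : ℕ} (h : i + j = k) (c : ℂ) (α : Form E X ℝ i) (β : Form E X ℝ j) :
    pullC E X ℝ k c (mul h α β) = mul h (pullC E X ℝ i c α) (pullC E X ℝ j c β) :=
  Subtype.ext (funext fun _ => wedge_compContinuousLinearMap (E := E) (E' := E) h _ _ _)

variable (E X 𝕜)

/-- The action of the complex structure on forms, `(Jα)(v₁, …, vₖ) = α(i v₁, …, i vₖ)`. -/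
noncomputable def J (k : ℕ) : Form E X 𝕜 k →ₗ[𝕜] Form E X 𝕜 k := pullC E X 𝕜 k Complex.I

/-- The inverse of `J`. -/
noncomputable def Jinv (k : ℕ) : Form E X 𝕜 k →ₗ[𝕜] Form E X 𝕜 k := pullC E X 𝕜 k (-Complex.I)

/-- The operator `d^c = J⁻¹ d J`. -/
noncomputable def dc (k : ℕ) : Form E X 𝕜 k →ₗ[𝕜] Form E X 𝕜 (k + 1) :=
  Jinv E X 𝕜 (k + 1) ∘ₗ d E X 𝕜 k ∘ₗ J E X 𝕜 k

variable {E X 𝕜}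

theorem J_Jinv {k : ℕ} (α : Form E X 𝕜 k) : J E X 𝕜 k (Jinv E X 𝕜 k α) = α := by
  rw [J, Jinv, pullC_pullC, neg_mul, Complex.I_mul_I, neg_neg, pullC_one]

theorem Jinv_J {k : ℕ} (α : Form E X 𝕜 k) : Jinv E X 𝕜 k (J E X 𝕜 k α) = α := by
  rw [J, Jinv, pullC_pullC, mul_neg, Complex.I_mul_I, neg_neg, pullC_one]

theorem dc_dc (k : ℕ) (α : Form E X 𝕜 k) : dc E X 𝕜 (k + 1) (dc E X 𝕜 k α) = 0 := by
  simp [dc, J_Jinv, d_d]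

theorem dc_leibniz {i j k : ℕ} (h : i + j = k) (h₁ : i + 1 + j = k + 1)
    (h₂ : i + (j + 1) = k + 1) (α : Form E X ℝ i) (β : Form E X ℝ j) :
    dc E X ℝ k (mul h α β) =
      mul h₁ (dc E X ℝ i α) β + (-1 : ℝ) ^ i • mul h₂ α (dc E X ℝ j β) := by
  simp only [dc, LinearMap.comp_apply]
  rw [J, pullC_mul, leibniz h h₁ h₂, map_add, map_smul, Jinv, pullC_mul, pullC_mul]
  have hα := Jinv_J α
  have hβ := Jinv_J β
  rw [J, Jinv] at hα hβ
  rw [hα, hβ]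
  rfl

theorem fderiv_clm_comp {F G : Type*} [NormedAddCommGroup F] [NormedSpace ℝ F]
    [NormedAddCommGroup G] [NormedSpace ℝ G] (P : F →L[ℝ] G) {g : E → F} {z : E}
    (hg : DifferentiableAt ℝ g z) : fderiv ℝ (fun y => P (g y)) z = P.comp (fderiv ℝ g z) :=
  (P.hasFDerivAt.comp z hg.hasFDerivAt).fderiv

theorem fderiv_comp_mulC {k : ℕ} {f : E → E [⋀^Fin k]→L[ℝ] 𝕜} {z : E} (c : ℂ)
    (hf : DifferentiableAt ℝ f z) :
    fderiv ℝ (fun y => (f y).compContinuousLinearMap (mulC E c)) z =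
      (ContinuousAlternatingMap.compContinuousLinearMapCLM (F := 𝕜) (ι := Fin k)
        (mulC E c)).comp (fderiv ℝ f z) :=
  ((ContinuousAlternatingMap.compContinuousLinearMapCLM (F := 𝕜) (ι := Fin k)
    (mulC E c)).hasFDerivAt.comp z hf.hasFDerivAt).fderiv

/-- In a holomorphic chart, `d^c` is the alternation of the derivative precomposed with `-i`. -/
theorem inChart_dc {k : ℕ} (α : Form E X 𝕜 k) {e : OpenPartialHomeomorph X E}
    (he : e ∈ atlas E X) {z : E} (hz : z ∈ e.target) :
    inChart e (dc E X 𝕜 k α).1 z = ContinuousAlternatingMap.alternatizeUncurryFin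
      ((fderiv ℝ (inChart e α.1) z).comp (mulC E (-Complex.I))) := by
  have h1 : inChart e (J E X 𝕜 k α).1 =ᶠ[𝓝 z]
      fun y => (inChart e α.1 y).compContinuousLinearMap (mulC E Complex.I) := by
    filter_upwards [e.open_target.mem_nhds hz] with y hy using inChart_pullC _ α he hy
  have h2 : inChart e (dc E X 𝕜 k α).1 z =
      (inChart e (d E X 𝕜 k (J E X 𝕜 k α)).1 z).compContinuousLinearMap (mulC E (-Complex.I)) :=
    inChart_pullC _ _ he hz
  rw [h2, inChart_d _ he hz, h1.extDeriv_eq, extDeriv,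
    fderiv_comp_mulC _ (differentiableAt_inChart α he hz)]
  ext v
  simp only [ContinuousAlternatingMap.compContinuousLinearMap_apply,
    ContinuousAlternatingMap.alternatizeUncurryFin_apply]
  refine Finset.sum_congr rfl fun i _ => ?_
  congr 1
  change (fderiv ℝ (inChart e α.1) z ((-Complex.I) • v i))
    (fun j => Complex.I • (-Complex.I) • v (i.succAbove j)) =
    (fderiv ℝ (inChart e α.1) z ((-Complex.I) • v i)) (fun j => v (i.succAbove j))
  simp [smul_smul]

theorem dc_d (k : ℕ) (α : Form E X 𝕜 k) :
    dc E X 𝕜 (k + 1) (d E X 𝕜 k α) = -d E X 𝕜 (k + 1) (dc E X 𝕜 k α) := by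
  refine eq_neg_of_add_eq_zero_left ?_
  refine Subtype.ext (ext_inChart fun e he z hz => ?_)
  set f := inChart e α.1 with hf
  have hc : ContDiffAt ℝ ∞ f z := contDiffAt_inChart α he hz
  have hD : DifferentiableAt ℝ (fderiv ℝ f) z :=
    (hc.fderiv_right (m := 1) (by norm_cast)).differentiableAt (by simp)
  set m := mulC E (-Complex.I) with hm
  set P := ContinuousAlternatingMap.alternatizeUncurryFinCLM ℝ E 𝕜 (n := k) with hP
  have h1 : inChart e (dc E X 𝕜 (k + 1) (d E X 𝕜 k α)).1 z =
      ContinuousAlternatingMap.alternatizeUncurryFin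
        (P ∘L ((fderiv ℝ (fderiv ℝ f) z).comp m)) := by
    rw [inChart_dc _ he hz, (inChart_d_eventuallyEq α he hz).fderiv_eq]
    have : fderiv ℝ (extDeriv f) z = P ∘L fderiv ℝ (fderiv ℝ f) z :=
      fderiv_clm_comp (F := E →L[ℝ] E [⋀^Fin k]→L[ℝ] 𝕜) P hD
    rw [this]
    rfl
  have h2 : inChart e (d E X 𝕜 (k + 1) (dc E X 𝕜 k α)).1 z =
      ContinuousAlternatingMap.alternatizeUncurryFin
        (P ∘L (((ContinuousLinearMap.compL ℝ E E (E [⋀^Fin k]→L[ℝ] 𝕜)).flip m).comp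
          (fderiv ℝ (fderiv ℝ f) z))) := by
    have h3 : inChart e (dc E X 𝕜 k α).1 =ᶠ[𝓝 z]
        fun y => P ((ContinuousLinearMap.compL ℝ E E (E [⋀^Fin k]→L[ℝ] 𝕜)).flip m
          (fderiv ℝ f y)) := by
      filter_upwards [e.open_target.mem_nhds hz] with y hy using inChart_dc α he hy
    rw [inChart_d _ he hz, h3.extDeriv_eq, extDeriv]
    have := fderiv_clm_comp (F := E →L[ℝ] E [⋀^Fin k]→L[ℝ] 𝕜)
      (P ∘L ((ContinuousLinearMap.compL ℝ E E (E [⋀^Fin k]→L[ℝ] 𝕜)).flip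
      m)) hD
    exact congrArg _ this
  have hsymm : ∀ u v, fderiv ℝ (fderiv ℝ f) z u v = fderiv ℝ (fderiv ℝ f) z v u := by
    have := hc.isSymmSndFDerivAt (by simp; norm_cast)
    exact fun u v => this u v
  have h4 : inChart e (dc E X 𝕜 (k + 1) (d E X 𝕜 k α)).1 z +
      inChart e (d E X 𝕜 (k + 1) (dc E X 𝕜 k α)).1 z = 0 := by
    rw [h1, h2, ← ContinuousAlternatingMap.alternatizeUncurryFin_add, ← ContinuousLinearMap.comp_add]
    refine ContinuousAlternatingMap.alternatizeUncurryFin_alternatizeUncurryFinCLM_comp_of_symmetric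
      fun u v => ?_
    change fderiv ℝ (fderiv ℝ f) z (m u) v + fderiv ℝ (fderiv ℝ f) z u (m v) =
      fderiv ℝ (fderiv ℝ f) z (m v) u + fderiv ℝ (fderiv ℝ f) z v (m u)
    rw [hsymm (m u) v, hsymm u (m v), add_comm]
  exact h4

variable (E X)

/-- The operator `d^c` on the de Rham algebra of real forms. -/
noncomputable def dcReal : (deRham E X).SecondDifferential where
  δ := dc E X ℝ
  δ_δ := dc_dc
  anticomm := dc_d
  leibniz := dc_leibniz

/-- The operator `∂ = (d + i d^c) / 2` on complex forms.  See `del_add_delbar`, `del_mem` and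
`delbar_mem`: `d = ∂ + ∂̄`, and `∂` and `∂̄` map `Ω^{p,q}` into `Ω^{p+1,q}` and `Ω^{p,q+1}`, so that
they are the two components of `d` on forms of pure type. -/
noncomputable def del (k : ℕ) : Form E X ℂ k →ₗ[ℂ] Form E X ℂ (k + 1) :=
  (1 / 2 : ℂ) • (d E X ℂ k + Complex.I • dc E X ℂ k)

/-- The operator `∂̄ = (d - i d^c) / 2` on complex forms; see the comments on `∂`. -/
noncomputable def delbar (k : ℕ) : Form E X ℂ k →ₗ[ℂ] Form E X ℂ (k + 1) :=
  (1 / 2 : ℂ) • (d E X ℂ k - Complex.I • dc E X ℂ k)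

/-- The space `Ω^{p,q}(X)` of forms of type `(p, q)`, `p + q = k`: the complex forms `α` of degree
`k` with `α(c v₁, …, c vₖ) = c^p c̄^q α(v₁, …, vₖ)` for all complex numbers `c`. -/
noncomputable def typeForm (p q k : ℕ) : Submodule ℂ (Form E X ℂ k) where
  carrier := {α | ∀ c : ℂ, pullC E X ℂ k c α = (c ^ p * (starRingEnd ℂ c) ^ q) • α}
  add_mem' hα hβ c := by rw [map_add, hα c, hβ c, smul_add]
  zero_mem' c := by rw [map_zero, smul_zero]
  smul_mem' a α hα c := by rw [map_smul, hα c, smul_comm]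

variable {E X}

theorem del_add_delbar (k : ℕ) (α : Form E X ℂ k) :
    del E X k α + delbar E X k α = d E X ℂ k α := by
  simp only [del, delbar, LinearMap.smul_apply, LinearMap.add_apply, LinearMap.sub_apply]
  module

/-- If multiplication by `c` acts on the values of `L` with the factor `w` and on the argument of
`L` with the factor `s`, then it acts on the alternation of `L` with the factor `w * s`. -/
theorem alternatize_weight {k : ℕ} {L : E →L[ℝ] E [⋀^Fin k]→L[ℝ] ℂ} (c w s : ℂ)
    (h1 : ∀ u, (L u).compContinuousLinearMap (mulC E c) = w • L u)
    (h2 : ∀ u, L (c • u) = s • L u) :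
    (ContinuousAlternatingMap.alternatizeUncurryFin L).compContinuousLinearMap (mulC E c) =
      (w * s) • ContinuousAlternatingMap.alternatizeUncurryFin L := by
  ext v
  simp only [ContinuousAlternatingMap.compContinuousLinearMap_apply,
    ContinuousAlternatingMap.smul_apply, ContinuousAlternatingMap.alternatizeUncurryFin_apply,
    Finset.smul_sum]
  refine Finset.sum_congr rfl fun i _ => ?_
  rw [smul_comm]
  congr 1
  have h3 := congrArg (fun A => A (i.removeNth v)) (h1 (c • v i))
  have h4 : (L (c • v i)) (fun j => c • i.removeNth v j) = w • L (c • v i) (i.removeNth v) := h3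
  rw [h2] at h4
  have h5 : (L (mulC E c (v i))) (i.removeNth (mulC E c ∘ v)) =
      (s • L (v i)) (fun j => c • i.removeNth v j) := by
    rw [← h2]
    rfl
  refine h5.trans (h4.trans ?_)
  rw [ContinuousAlternatingMap.smul_apply, smul_smul]

theorem inChart_half {k : ℕ} (α : Form E X ℂ k) {e : OpenPartialHomeomorph X E}
    (he : e ∈ atlas E X) {z : E} (hz : z ∈ e.target) (a : ℂ) :
    inChart e ((1 / 2 : ℂ) • (d E X ℂ k α + a • dc E X ℂ k α)).1 z =
      ContinuousAlternatingMap.alternatizeUncurryFin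
        ((1 / 2 : ℂ) • (fderiv ℝ (inChart e α.1) z +
          a • (fderiv ℝ (inChart e α.1) z).comp (mulC E (-Complex.I)))) := by
  rw [ContinuousAlternatingMap.alternatizeUncurryFin_smul,
    ContinuousAlternatingMap.alternatizeUncurryFin_add,
    ContinuousAlternatingMap.alternatizeUncurryFin_smul, ← inChart_dc α he hz]
  have := inChart_d α he hz
  rw [extDeriv] at this
  rw [← this]
  rfl

theorem fderiv_weight {p q k : ℕ} {α : Form E X ℂ k} (hα : α ∈ typeForm E X p q k)
    {e : OpenPartialHomeomorph X E} (he : e ∈ atlas E X) {z : E} (hz : z ∈ e.target) (c : ℂ)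
    (u : E) :
    (fderiv ℝ (inChart e α.1) z u).compContinuousLinearMap (mulC E c) =
      (c ^ p * (starRingEnd ℂ c) ^ q) • fderiv ℝ (inChart e α.1) z u := by
  have h1 : (fun y => (inChart e α.1 y).compContinuousLinearMap (mulC E c)) =ᶠ[𝓝 z]
      (c ^ p * (starRingEnd ℂ c) ^ q) • inChart e α.1 := by
    filter_upwards [e.open_target.mem_nhds hz] with y hy
    rw [← inChart_pullC c α he hy, hα c]
    rfl
  have h2 := h1.fderiv_eq (𝕜 := ℝ)
  rw [fderiv_comp_mulC c (differentiableAt_inChart α he hz),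
    fderiv_const_smul (differentiableAt_inChart α he hz) (c ^ p * (starRingEnd ℂ c) ^ q)] at h2
  exact congrArg (fun A : E →L[ℝ] E [⋀^Fin k]→L[ℝ] ℂ => A u) h2

theorem smul_real_decomp {k : ℕ} (L : E →L[ℝ] E [⋀^Fin k]→L[ℝ] ℂ) (c : ℂ) (u : E) :
    L (c • u) = (c.re : ℂ) • L u + (c.im : ℂ) • L (Complex.I • u) := by
  have : c • u = c.re • u + c.im • (Complex.I • u) := by
    conv_lhs => rw [← Complex.re_add_im c]
    rw [add_smul, mul_smul]
    rfl
  rw [this, map_add, map_smul, map_smul]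
  rfl

theorem half_mem {p q k : ℕ} {α : Form E X ℂ k} (hα : α ∈ typeForm E X p q k) (a : ℂ)
    (s : ℂ → ℂ) (hs : ∀ c : ℂ, s c = c.re + a * c.im) (ha : a * a = -1) (c : ℂ) :
    pullC E X ℂ (k + 1) c ((1 / 2 : ℂ) • (d E X ℂ k α + a • dc E X ℂ k α)) =
      ((c ^ p * (starRingEnd ℂ c) ^ q) * s c) •
        ((1 / 2 : ℂ) • (d E X ℂ k α + a • dc E X ℂ k α)) := by
  refine Subtype.ext (ext_inChart fun e he z hz => ?_)
  set L := fderiv ℝ (inChart e α.1) z with hL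
  have hw := alternatize_weight (L := (1 / 2 : ℂ) • (L + a • L.comp (mulC E (-Complex.I)))) c
    (c ^ p * (starRingEnd ℂ c) ^ q) (s c) (fun u => ?_) (fun u => ?_)
  · rw [inChart_pullC c _ he hz, inChart_half α he hz a, hw, ← inChart_half α he hz a]
    rfl
  · have h1 := fderiv_weight hα he hz c u
    have h2 := fderiv_weight hα he hz c (-Complex.I • u)
    rw [← hL] at h1 h2
    ext v
    have h1' := congrArg (fun A => A v) h1
    have h2' := congrArg (fun A => A v) h2
    simp only [ContinuousAlternatingMap.compContinuousLinearMap_apply,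
      ContinuousAlternatingMap.smul_apply] at h1' h2'
    change (1 / 2 : ℂ) • (L u (mulC E c ∘ v) + a • L (-Complex.I • u) (mulC E c ∘ v)) =
      (c ^ p * (starRingEnd ℂ c) ^ q) • ((1 / 2 : ℂ) • (L u v + a • L (-Complex.I • u) v))
    rw [h1', h2']
    module
  · change (1 / 2 : ℂ) • (L (c • u) + a • L (-Complex.I • c • u)) =
      s c • ((1 / 2 : ℂ) • (L u + a • L (-Complex.I • u)))
    have e1 : -Complex.I • c • u = (-Complex.I * c) • u := smul_smul _ _ _
    rw [e1, smul_real_decomp L c, smul_real_decomp L (-Complex.I * c),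
      smul_real_decomp L (-Complex.I), hs]
    simp only [Complex.mul_re, Complex.mul_im, Complex.neg_re, Complex.neg_im, Complex.I_re,
      Complex.I_im]
    push_cast
    match_scalars
    · ring
    · linear_combination (1 / 2 : ℂ) * c.im * ha

theorem del_mem {p q k : ℕ} {α : Form E X ℂ k} (hα : α ∈ typeForm E X p q k) :
    del E X k α ∈ typeForm E X (p + 1) q (k + 1) := fun c => by
  have h := half_mem hα Complex.I id (fun c => by simp [mul_comm Complex.I]) Complex.I_mul_I c
  refine h.trans (congrArg (fun t : ℂ => t • del E X k α) ?_)
  simp only [id]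
  ring

theorem delbar_mem {p q k : ℕ} {α : Form E X ℂ k} (hα : α ∈ typeForm E X p q k) :
    delbar E X k α ∈ typeForm E X p (q + 1) (k + 1) := fun c => by
  have h := half_mem hα (-Complex.I) (starRingEnd ℂ) (fun c => by
    apply Complex.ext <;> simp)
    (by rw [neg_mul_neg, Complex.I_mul_I]) c
  have e : delbar E X k α = (1 / 2 : ℂ) • (d E X ℂ k α + (-Complex.I) • dc E X ℂ k α) := by
    simp only [delbar, LinearMap.smul_apply, LinearMap.sub_apply]
    module
  rw [e, h]
  congr 1
  ring

variable (E X)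

/-- The image of `∂∂̄ : Ω^{p-1,q-1} → Ω^{p,q}`, `p + q = k`. -/
noncomputable def imDelDelbar : (p q k : ℕ) → Submodule ℂ (Form E X ℂ k)
  | p + 1, q + 1, k + 2 => (typeForm E X p q k).map (del E X (k + 1) ∘ₗ delbar E X k)
  | _, _, _ => ⊥

/-- The image of `∂ : Ω^{p-1,q} → Ω^{p,q}`, `p + q = k`. -/
noncomputable def imDel : (p q k : ℕ) → Submodule ℂ (Form E X ℂ k)
  | p + 1, q, k + 1 => (typeForm E X p q k).map (del E X k)
  | _, _, _ => ⊥

/-- The image of `∂̄ : Ω^{p,q-1} → Ω^{p,q}`, `p + q = k`. -/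
noncomputable def imDelbar : (p q k : ℕ) → Submodule ℂ (Form E X ℂ k)
  | p, q + 1, k + 1 => (typeForm E X p q k).map (delbar E X k)
  | _, _, _ => ⊥

/-- `ker ∂ ∩ ker ∂̄` in `Ω^{p,q}`, `p + q = k`. -/
noncomputable def bottChernCocycles (p q k : ℕ) : Submodule ℂ (Form E X ℂ k) :=
  typeForm E X p q k ⊓ (LinearMap.ker (del E X k) ⊓ LinearMap.ker (delbar E X k))

/-- `ker ∂∂̄` in `Ω^{p,q}`, `p + q = k`. -/
noncomputable def aeppliCocycles (p q k : ℕ) : Submodule ℂ (Form E X ℂ k) :=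
  typeForm E X p q k ⊓ LinearMap.ker (del E X (k + 1) ∘ₗ delbar E X k)

/-- The Bott-Chern cohomology `H_BC^{p,q}(X) = (ker ∂ ∩ ker ∂̄) / im ∂∂̄`, `p + q = k`. -/
abbrev BottChern (p q k : ℕ) : Type (max u v) :=
  bottChernCocycles E X p q k ⧸
    (imDelDelbar E X p q k).comap (bottChernCocycles E X p q k).subtype

/-- The Aeppli cohomology `H_A^{p,q}(X) = ker ∂∂̄ / (im ∂ + im ∂̄)`, `p + q = k`. -/
abbrev Aeppli (p q k : ℕ) : Type (max u v) :=
  aeppliCocycles E X p q k ⧸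
    (imDel E X p q k ⊔ imDelbar E X p q k).comap (aeppliCocycles E X p q k).subtype

variable {E X}

theorem bottChernCocycles_le (p q k : ℕ) :
    bottChernCocycles E X p q k ≤ aeppliCocycles E X p q k := fun α hα => by
  refine ⟨hα.1, ?_⟩
  refine LinearMap.mem_ker.2 ?_
  rw [LinearMap.comp_apply, LinearMap.mem_ker.1 hα.2.2, map_zero]

theorem imDelDelbar_le (p q k : ℕ) : imDelDelbar E X p q k ≤ imDel E X p q k := by
  rcases p with _ | p
  · simp [imDelDelbar]
  rcases q with _ | q
  · simp [imDelDelbar]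
  rcases k with _ | _ | k
  · simp [imDelDelbar]
  · simp [imDelDelbar]
  · rintro _ ⟨α, hα, rfl⟩
    exact ⟨delbar E X k α, delbar_mem hα, rfl⟩

variable (E X)

/-- The map `H_BC^{p,q}(X) → H_A^{p,q}(X)` induced by the identity. -/
noncomputable def bottChernToAeppli (p q k : ℕ) : BottChern E X p q k →ₗ[ℂ] Aeppli E X p q k :=
  Submodule.mapQ _ _ (Submodule.inclusion (bottChernCocycles_le p q k)) fun _ hα =>
    (le_sup_left : imDel E X p q k ≤ _) (imDelDelbar_le p q k hα)

/-- The `∂∂̄`-Lemma property: the natural map `H_BC(X) → H_A(X)` is injective. -/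
def DelDelbarLemma : Prop :=
  ∀ p q k : ℕ, p + q = k → Function.Injective (bottChernToAeppli E X p q k)

end

end Complex

end DifferentialForms

open scoped Manifold ContDiff

/-!
The argument has an algebraic half and an analytic half.

*Algebra.* Let `(A, d)` be a CDGA with a second differential `δ` that anticommutes with `d`.  If
every `d`-exact `δ`-closed element and every `δ`-exact `d`-closed element lies in the image of `dδ`
(`CDGA.SecondDifferential.DDLemma`), then both arrows of `A ← ker δ → H_δ(A)` are quasi-isomorphisms
and `d` induces zero on `H_δ(A)`: each of these facts is a short diagram chase
(`DDLemma.incl_isQuasiIso`, `DDLemma.proj_isQuasiIso`, `DDLemma.cohomology_d`).  A CDGA with zero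
differential is isomorphic to its own cohomology algebra, and a quasi-isomorphism induces an
isomorphism of cohomology algebras, so such a roof connects `A` to `H(A)`; thus `A` is formal
(`CDGA.isFormal_of_roof`).

*Forms.* It remains to deduce the `dd^c`-Lemma for real forms from the `∂∂̄`-Lemma, which is about
forms of pure type.  At a point, `α(c v₁, …, c vₖ)` is a homogeneous polynomial of degree `k` in `c`
and its conjugate.  Its coefficients are the values of the components of `α` of type `(p, q)`, and
they are obtained by averaging `α(c v₁, …, c vₖ)` with weights over roots of unity `c`; this
exhibits the components as smooth forms (`DifferentialForms.sum_typeProj`,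
`DifferentialForms.typeProj_mem`).  Since `∂` and `∂̄` shift types, the hypotheses of the
`∂∂̄`-Lemma pass to the components (`DelDelbarLemma.typeProj_mem_imDelDelbar`).  Because
`∂∂̄ = -(i / 2) d d^c` and `d`, `d^c` are real operators, taking real parts gives the `dd^c`-Lemma
for real forms (`DelDelbarLemma.ddLemma`).
-/

namespace CDGA

/-! ### Quasi-isomorphisms and cohomology algebras -/

namespace Hom

variable {A B : CDGA.{u}}

/-- A morphism induces an injection in cohomology if it reflects exactness of cocycles. -/
theorem mapCohomology_injective (f : Hom A B) {k : ℕ}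
    (h : ∀ x : A.obj k, A.d k x = 0 → f.toFun k x ∈ B.dSelf.image k → x ∈ A.dSelf.image k) :
    Function.Injective (f.mapCohomology k) := by
  refine (injective_iff_map_eq_zero _).2 fun x hx => ?_
  induction x using Submodule.Quotient.induction_on with | _ x
  exact (Submodule.Quotient.mk_eq_zero _).2
    (h x.1 x.2 ((Submodule.Quotient.mk_eq_zero (B.dSelf.imageInKernel k)).1 hx))

/-- A morphism induces a surjection in cohomology if it hits every cocycle up to an exact one. -/
theorem mapCohomology_surjective (f : Hom A B) {k : ℕ}
    (h : ∀ y : B.obj k, B.d k y = 0 →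
      ∃ x : A.obj k, A.d k x = 0 ∧ f.toFun k x - y ∈ B.dSelf.image k) :
    Function.Surjective (f.mapCohomology k) := by
  intro y
  induction y using Submodule.Quotient.induction_on with | _ y
  obtain ⟨x, hx, hxy⟩ := h y.1 y.2
  exact ⟨(A.dSelf.imageInKernel k).mkQ ⟨x, hx⟩, (Submodule.Quotient.eq _).2 hxy⟩

/-- A degreewise bijective morphism is a quasi-isomorphism. -/
theorem isQuasiIso_of_bijective (f : Hom A B) (hf : ∀ k, Function.Bijective (f.toFun k)) :
    f.IsQuasiIso := by
  refine fun k => ⟨f.mapCohomology_injective fun x _ hx => ?_,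
    f.mapCohomology_surjective fun y hy => ?_⟩
  · cases k with
    | zero =>
      have h0 : f.toFun 0 x = 0 := hx
      have : x = 0 := (hf 0).1 (h0.trans (map_zero _).symm)
      rw [this]
      exact zero_mem _
    | succ k =>
      obtain ⟨z, hz⟩ := hx
      obtain ⟨y, rfl⟩ := (hf k).2 z
      exact ⟨y, (hf (k + 1)).1 ((f.map_d k y).trans hz)⟩
  · obtain ⟨x, rfl⟩ := (hf k).2 y
    refine ⟨x, (hf (k + 1)).1 ?_, ?_⟩
    · rw [f.map_d, hy, map_zero]
    · rw [sub_self]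
      exact zero_mem _

/-- The morphism of cohomology algebras induced by a morphism. -/
def onCohomology (f : Hom A B) : Hom A.cohomology B.cohomology where
  toFun k := f.mapCohomology k
  map_d k x := by
    rw [A.cohomology_d, B.cohomology_d]
    exact map_zero _
  map_one := congrArg (Submodule.mkQ _) (Subtype.ext f.map_one)
  map_mul h x y := by
    induction x using Submodule.Quotient.induction_on with | _ x
    induction y using Submodule.Quotient.induction_on with | _ y
    exact congrArg (Submodule.mkQ _) (Subtype.ext (f.map_mul h x.1 y.1))

theorem IsQuasiIso.onCohomology {f : Hom A B} (hf : f.IsQuasiIso) : f.onCohomology.IsQuasiIso :=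
  f.onCohomology.isQuasiIso_of_bijective hf

end Hom

/-- A CDGA with zero differential maps to its cohomology algebra by sending each element, which is
a cocycle, to its class. -/
def toCohomology (A : CDGA.{u}) (hA : ∀ k, A.d k = 0) : Hom A A.cohomology where
  toFun k := (A.dSelf.imageInKernel k).mkQ ∘ₗ
    LinearMap.codRestrict (LinearMap.ker (A.d k)) LinearMap.id fun x => by
      rw [hA k, LinearMap.ker_zero]
      trivial
  map_d k x := by
    have hx : A.d k x = 0 := by rw [hA, LinearMap.zero_apply]
    rw [A.cohomology_d, hx]
    exact map_zero _
  map_one := rfl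
  map_mul _ _ _ := rfl

theorem toCohomology_isQuasiIso (A : CDGA.{u}) (hA : ∀ k, A.d k = 0) :
    (A.toCohomology hA).IsQuasiIso := by
  refine Hom.isQuasiIso_of_bijective _ fun k => ⟨?_, fun y => ?_⟩
  · refine (injective_iff_map_eq_zero _).2 fun x hx => ?_
    have h : x ∈ A.dSelf.image k :=
      (Submodule.Quotient.mk_eq_zero (A.dSelf.imageInKernel k)).1 hx
    cases k with
    | zero => exact h
    | succ k =>
      obtain ⟨z, rfl⟩ := h
      change A.d k z = 0
      rw [hA, LinearMap.zero_apply]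
  · induction y using Submodule.Quotient.induction_on with | _ y
    exact ⟨y.1, rfl⟩

/-- A CDGA that is joined to a CDGA with zero differential by a roof of quasi-isomorphisms is
formal. -/
theorem isFormal_of_roof {A K C : CDGA.{u}} (i : Hom K A) (p : Hom K C) (hi : i.IsQuasiIso)
    (hp : p.IsQuasiIso) (hC : ∀ k, C.d k = 0) : A.IsFormal := by
  have of {A B : CDGA.{u}} {f : Hom A B} (hf : f.IsQuasiIso) : WeaklyEquivalent A B :=
    .rel _ _ ⟨f, hf⟩
  exact ((((of hi).symm _ _).trans _ _ _ (of hp)).trans _ _ _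
    (of (C.toCohomology_isQuasiIso hC))).trans _ _ _
    (((of hp.onCohomology).symm _ _).trans _ _ _ (of hi.onCohomology))

/-! ### The `dδ`-Lemma for a CDGA -/

namespace SecondDifferential

variable {A : CDGA.{u}} {D : A.SecondDifferential}

/-- The two halves of the `dδ`-Lemma: a `d`-exact `δ`-closed element, and a `δ`-exact `d`-closed
element, lies in the image of `dδ = -δd`.  With the convention that the images in degree zero
vanish, this covers elements of degree one, which have to be zero. -/
structure DDLemma (D : A.SecondDifferential) : Prop where
  d_exact : ∀ (k : ℕ) (x : A.obj k), D.δ (k + 1) (A.d k x) = 0 → ∃ y ∈ D.image k, A.d k x = A.d k y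
  δ_exact : ∀ (k : ℕ) (x : A.obj k), A.d (k + 1) (D.δ k x) = 0 →
    ∃ y ∈ A.dSelf.image k, D.δ k x = D.δ k y

/-- An exact element of `ker δ` is a boundary in `ker δ`, because it is `dy` with `y ∈ im δ`.  A closed
`x` has `δx = δy` with `y` exact, so `x - y` is a representative of its class in `ker δ`. -/
theorem DDLemma.incl_isQuasiIso (h : D.DDLemma) : D.incl.IsQuasiIso := by
  refine fun k => ⟨Hom.mapCohomology_injective _ fun x _ hx => ?_,
    Hom.mapCohomology_surjective _ fun x hx => ?_⟩
  · cases k with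
    | zero => exact Subtype.ext hx
    | succ k =>
      obtain ⟨z, hz⟩ := hx
      have hz : A.d k z = x.1 := hz
      obtain ⟨y, hy, hzy⟩ := h.d_exact k z (by rw [hz]; exact x.2)
      exact ⟨⟨y, D.image_le_ker k hy⟩, Subtype.ext (hzy.symm.trans hz)⟩
  · obtain ⟨y, hy, hxy⟩ := h.δ_exact k x (by
      rw [← neg_eq_zero, ← D.anticomm, hx, map_zero])
    have hdy : A.d k y = 0 := A.dSelf.image_le_ker k hy
    refine ⟨⟨x - y, ?_⟩, Subtype.ext ?_, ?_⟩
    · rw [LinearMap.mem_ker, map_sub, hxy, sub_self]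
    · change A.d k (x - y) = 0
      rw [map_sub, hx, hdy, sub_zero]
    · change x - y - x ∈ A.dSelf.image k
      rw [sub_sub_cancel_left]
      exact neg_mem hy

/-- If `δx = 0`, then `dx` is in `im dδ = im δd`, hence zero in `H_δ`. -/
theorem DDLemma.cohomology_d (h : D.DDLemma) (k : ℕ) : D.cohomology.d k = 0 := by
  refine LinearMap.ext fun x => ?_
  induction x using Submodule.Quotient.induction_on with | _ x
  refine (Submodule.Quotient.mk_eq_zero _).2 ?_
  change A.d k x.1 ∈ D.image (k + 1)
  obtain ⟨y, hy, hxy⟩ := h.d_exact k x.1 (by rw [D.anticomm, x.2, map_zero, neg_zero])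
  rw [hxy]
  exact D.d_mem_image hy

/-- The mirror image of `DDLemma.incl_isQuasiIso`, with the roles of `d` and `δ` exchanged. -/
theorem DDLemma.proj_isQuasiIso (h : D.DDLemma) : D.proj.IsQuasiIso := by
  refine fun k => ⟨Hom.mapCohomology_injective _ fun x hx hx' => ?_,
    Hom.mapCohomology_surjective _ fun x _ => ?_⟩
  · have hx : A.d k x.1 = 0 := congrArg Subtype.val hx
    -- The differential of `H_δ` is zero, so the class of `x` in `H_δ` is exact only if it is zero.
    have hxδ : x.1 ∈ D.image k := by
      refine (Submodule.Quotient.mk_eq_zero (D.imageInKernel k)).1 ?_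
      cases k with
      | zero => exact hx'
      | succ k =>
        obtain ⟨z, hz⟩ := hx'
        have hz : D.cohomology.d k z = D.proj.toFun (k + 1) x := hz
        rw [h.cohomology_d, LinearMap.zero_apply] at hz
        exact hz.symm
    cases k with
    | zero => exact Subtype.ext hxδ
    | succ k =>
      obtain ⟨z, hz⟩ := hxδ
      obtain ⟨y, hy, hzy⟩ := h.δ_exact k z (by rw [hz, hx])
      cases k with
      | zero =>
        rw [(Submodule.mem_bot ℝ).1 hy, map_zero, hz] at hzy
        exact ⟨0, Subtype.ext ((map_zero _).trans hzy.symm)⟩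
      | succ k =>
        obtain ⟨w, rfl⟩ := hy
        refine ⟨-⟨D.δ k w, D.δ_δ k w⟩, Subtype.ext ?_⟩
        change A.d (k + 1) (-D.δ k w) = x.1
        rw [map_neg, ← D.anticomm, ← hz]
        exact hzy.symm
  · induction x using Submodule.Quotient.induction_on with | _ x
    obtain ⟨y, hy, hxy⟩ := h.d_exact k x.1 (by rw [D.anticomm, x.2, map_zero, neg_zero])
    refine ⟨x - ⟨y, D.image_le_ker k hy⟩, Subtype.ext ?_, ?_⟩
    · change A.d k (x.1 - y) = 0
      rw [map_sub, hxy, sub_self]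
    · have : D.proj.toFun k (x - ⟨y, D.image_le_ker k hy⟩) -
          D.proj.toFun k x = 0 := by
        refine sub_eq_zero.2 ((Submodule.Quotient.eq _).2 ?_)
        change x.1 - y - x.1 ∈ D.image k
        rw [sub_sub_cancel_left]
        exact neg_mem hy
      exact (congrArg (· ∈ D.cohomology.dSelf.image k) this).mpr (zero_mem _)

theorem DDLemma.isFormal (h : D.DDLemma) : A.IsFormal :=
  isFormal_of_roof _ _ h.incl_isQuasiIso h.proj_isQuasiIso h.cohomology_d

end SecondDifferential

end CDGA

/-! ### Bihomogeneous functions of a complex variable -/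

namespace Bihomogeneous

open Finset

/-- The functions `ℂ → ℂ` that are homogeneous polynomials of degree `k` in `c` and its conjugate;
equivalently, in the real and imaginary parts of `c`. -/
def space (k : ℕ) : Submodule ℂ (ℂ → ℂ) :=
  Submodule.span ℂ {F | ∃ p q, p + q = k ∧ F = fun c => c ^ p * starRingEnd ℂ c ^ q}

theorem monomial_mem {p q k : ℕ} (h : p + q = k) :
    (fun c : ℂ => c ^ p * starRingEnd ℂ c ^ q) ∈ space k :=
  Submodule.subset_span ⟨p, q, h, rfl⟩

theorem mul_mem {j k : ℕ} {F G : ℂ → ℂ} (hF : F ∈ space j) (hG : G ∈ space k) :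
    F * G ∈ space (j + k) := by
  have h := Submodule.mul_mem_mul hF hG
  rw [space, space, Submodule.span_mul_span] at h
  refine Submodule.span_mono ?_ h
  rintro _ ⟨_, ⟨p, q, rfl, rfl⟩, _, ⟨p', q', rfl, rfl⟩, rfl⟩
  refine ⟨p + p', q + q', by omega, funext fun c => ?_⟩
  simp only [Pi.mul_apply, pow_add]
  ring

theorem prod_mem {ι : Type*} (t : Finset ι) {F : ι → ℂ → ℂ} (hF : ∀ i, F i ∈ space 1) :
    ∏ i ∈ t, F i ∈ space #t := by
  classical
  induction t using Finset.induction_on with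
  | empty => simpa [Pi.one_def] using monomial_mem (add_zero 0)
  | insert a t ha ih =>
    rw [prod_insert ha, card_insert_of_notMem ha, add_comm]
    exact mul_mem (hF a) ih

theorem re_mem : (fun c : ℂ => (c.re : ℂ)) ∈ space 1 := by
  have h := Submodule.smul_mem _ (1 / 2 : ℂ)
    (add_mem (monomial_mem (add_zero 1)) (monomial_mem (zero_add 1)))
  refine (congrArg (· ∈ space 1) (funext fun c => ?_)).mp h
  simp [Complex.re_eq_add_conj]
  ring

theorem im_mem : (fun c : ℂ => (c.im : ℂ)) ∈ space 1 := by
  have h := Submodule.smul_mem _ (-Complex.I / 2)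
    (sub_mem (monomial_mem (add_zero 1)) (monomial_mem (zero_add 1)))
  refine (congrArg (· ∈ space 1) (funext fun c => ?_)).mp h
  simp [Complex.im_eq_sub_conj, div_eq_mul_inv]
  ring

/-- A real multilinear form in `k` complex vectors is bihomogeneous of degree `k` in a complex
scalar by which all the vectors are multiplied. -/
theorem multilinear_smul_mem {E : Type*} [NormedAddCommGroup E] [NormedSpace ℂ E] {k : ℕ}
    (f : MultilinearMap ℝ (fun _ : Fin k => E) ℂ) (v : Fin k → E) :
    (fun c : ℂ => f (fun i => c • v i)) ∈ space k := by
  have h : (fun c : ℂ => f (fun i => c • v i)) = ∑ s : Finset (Fin k),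
      f (s.piecewise v (fun i => Complex.I • v i)) •
        ∏ i : Fin k, (fun c : ℂ => if i ∈ s then (c.re : ℂ) else (c.im : ℂ)) := by
    funext c
    have h1 : (fun i => c • v i) = (fun i => c.re • v i) + fun i => c.im • Complex.I • v i := by
      funext i
      conv_lhs => rw [← Complex.re_add_im c]
      rw [add_smul, mul_smul]
      rfl
    rw [h1, f.map_add_univ, Finset.sum_apply]
    refine sum_congr rfl fun s _ => ?_
    have h2 : s.piecewise (fun i => c.re • v i) (fun i => c.im • Complex.I • v i) =
        fun i => (if i ∈ s then c.re else c.im) • s.piecewise v (fun i => Complex.I • v i) i := by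
      funext i
      by_cases hi : i ∈ s <;> simp [hi]
    rw [h2, f.map_smul_univ]
    simp only [Pi.smul_apply, Finset.prod_apply, smul_eq_mul, Complex.real_smul]
    rw [mul_comm]
    congr 1
    push_cast
    exact prod_congr rfl fun i _ => by split_ifs <;> rfl
  rw [h]
  refine sum_mem fun s _ => Submodule.smul_mem _ _ ?_
  have := prod_mem (univ : Finset (Fin k))
    (F := fun i c => if i ∈ s then (c.re : ℂ) else (c.im : ℂ)) fun i => by
      by_cases hi : i ∈ s
      · simpa [hi] using re_mem
      · simpa [hi] using im_mem
  rwa [card_fin] at this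

/-- A primitive root of unity of order `2 k + 1`. -/
noncomputable def root (k : ℕ) : ℂ :=
  Complex.exp (2 * Real.pi * Complex.I / ((2 * k + 1 : ℕ) : ℂ))

theorem root_isPrimitiveRoot (k : ℕ) : IsPrimitiveRoot (root k) (2 * k + 1) :=
  Complex.isPrimitiveRoot_exp _ (by omega)

theorem conj_root (k : ℕ) : starRingEnd ℂ (root k) = (root k)⁻¹ :=
  (Complex.inv_eq_conj (Complex.norm_eq_one_of_pow_eq_one (root_isPrimitiveRoot k).pow_eq_one
    (by omega))).symm

/-- The coefficient of `c ^ p * c̄ ^ q` in a bihomogeneous function of degree `k = p + q`, as an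
average over the roots of unity of order `2 k + 1`.  On the unit circle the monomial is
`c ^ (2 p - k)`, and the exponents `2 p - k`, for `p ≤ k`, are distinct modulo `2 k + 1`. -/
noncomputable def coeff (k p q : ℕ) : (ℂ → ℂ) →ₗ[ℂ] ℂ :=
  ((2 * k + 1 : ℕ) : ℂ)⁻¹ • ∑ j ∈ range (2 * k + 1),
    (starRingEnd ℂ (root k ^ j) ^ p * (root k ^ j) ^ q) • LinearMap.proj (root k ^ j)

theorem coeff_apply (k p q : ℕ) (F : ℂ → ℂ) :
    coeff k p q F = ((2 * k + 1 : ℕ) : ℂ)⁻¹ • ∑ j ∈ range (2 * k + 1),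
      (starRingEnd ℂ (root k ^ j) ^ p * (root k ^ j) ^ q) • F (root k ^ j) := by
  simp [coeff]

theorem coeff_monomial {k p q p' q' : ℕ} (h : p + q = k) (h' : p' + q' = k) :
    coeff k p q (fun c => c ^ p' * starRingEnd ℂ c ^ q') = if p = p' then 1 else 0 := by
  have hr := root_isPrimitiveRoot k
  have h0 : root k ≠ 0 := hr.ne_zero (by omega)
  have hN : ((2 * k + 1 : ℕ) : ℂ) ≠ 0 := Nat.cast_ne_zero.2 (by omega)
  set η : ℂ := root k ^ (2 * ((p' : ℤ) - p)) with hη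
  have hsum : ∀ j : ℕ, (starRingEnd ℂ (root k ^ j) ^ p * (root k ^ j) ^ q) •
      ((root k ^ j) ^ p' * starRingEnd ℂ (root k ^ j) ^ q') = η ^ j := fun j => by
    rw [map_pow, conj_root, hη, smul_eq_mul]
    simp only [← zpow_natCast, ← zpow_mul, inv_zpow', ← zpow_add₀ h0]
    congr 1
    have : (q : ℤ) - q' = p' - p := by omega
    linear_combination (j : ℤ) * this
  rw [coeff_apply]
  simp only [hsum]
  split_ifs with hp
  · have : η = 1 := by rw [hη, hp, sub_self, mul_zero, zpow_zero]
    simp only [this, one_pow, sum_const, card_range, nsmul_eq_mul, mul_one, smul_eq_mul]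
    exact inv_mul_cancel₀ hN
  · have h1 : η ≠ 1 := fun h1 => by
      have h2 := (hr.zpow_eq_one_iff_dvd _).1 h1
      have h3 := Int.eq_zero_of_abs_lt_dvd h2 (by rw [abs_lt]; push_cast; omega)
      omega
    have h2 : η ^ (2 * k + 1) = 1 := by
      rw [hη, ← zpow_natCast, ← zpow_mul, mul_comm, zpow_mul, zpow_natCast, hr.pow_eq_one, one_zpow]
    rw [geom_sum_eq h1, h2, sub_self, zero_div, smul_zero]

theorem eq_sum_coeff {k : ℕ} {F : ℂ → ℂ} (hF : F ∈ space k) (c : ℂ) :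
    F c = ∑ pq ∈ antidiagonal k, coeff k pq.1 pq.2 F * (c ^ pq.1 * starRingEnd ℂ c ^ pq.2) := by
  induction hF using Submodule.span_induction with
  | mem F hF =>
    obtain ⟨p, q, h, rfl⟩ := hF
    rw [sum_eq_single (p, q)]
    · simp [coeff_monomial h h]
    · intro pq hpq hne
      have hpq := mem_antidiagonal.1 hpq
      rw [coeff_monomial hpq h, if_neg, zero_mul]
      intro h1
      exact hne (Prod.ext h1 (by simp only; omega))
    · intro h1
      exact absurd (mem_antidiagonal.2 h) h1
  | zero => simp
  | add F G _ _ hF hG => simp only [Pi.add_apply, hF, hG, map_add, add_mul, sum_add_distrib]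
  | smul a F _ hF => simp only [Pi.smul_apply, hF, map_smul, smul_eq_mul, mul_sum, mul_assoc]

/-- Replacing `F` by `F (c * ·)` multiplies the coefficient of each monomial by its value at `c`. -/
theorem coeff_comp_mul {k p q : ℕ} (h : p + q = k) {F : ℂ → ℂ} (hF : F ∈ space k) (c : ℂ) :
    coeff k p q (fun a => F (c * a)) = (c ^ p * starRingEnd ℂ c ^ q) * coeff k p q F := by
  induction hF using Submodule.span_induction with
  | mem F hF =>
    obtain ⟨p', q', h', rfl⟩ := hF
    have : (fun a => (c * a) ^ p' * starRingEnd ℂ (c * a) ^ q') =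
        (c ^ p' * starRingEnd ℂ c ^ q') • fun a => a ^ p' * starRingEnd ℂ a ^ q' := by
      funext a
      simp only [Pi.smul_apply, smul_eq_mul, map_mul, mul_pow]
      ring
    rw [this, map_smul, coeff_monomial h h', smul_eq_mul]
    split_ifs with hp
    · obtain rfl : q = q' := by omega
      rw [hp]
    · simp
  | zero =>
    have : (fun a => (0 : ℂ → ℂ) (c * a)) = 0 := rfl
    rw [this, map_zero, mul_zero]
  | add F G _ _ hF hG =>
    have : (fun a => (F + G) (c * a)) = (fun a => F (c * a)) + fun a => G (c * a) := rfl
    rw [this, map_add, hF, hG, map_add, mul_add]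
  | smul a F _ hF =>
    have : (fun x => (a • F) (c * x)) = a • fun x => F (c * x) := rfl
    rw [this, map_smul, hF, map_smul, smul_eq_mul, smul_eq_mul]
    ring

end Bihomogeneous

namespace DifferentialForms

open scoped Topology

/-! ### Change of coefficients and evaluation of forms -/

section Coefficients

variable {E : Type u} [NormedAddCommGroup E] [NormedSpace ℝ E]
variable {M : Type v} [TopologicalSpace M] [ChartedSpace E M]
variable {𝕜 𝕜' : Type} [NormedField 𝕜] [NormedAlgebra ℝ 𝕜] [NormedField 𝕜'] [NormedAlgebra ℝ 𝕜']

/-- Composition of the values of a form with a real linear map. -/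
noncomputable def mapCoeff (P : 𝕜 →L[ℝ] 𝕜') {k : ℕ} (α : Form E M 𝕜 k) : Form E M 𝕜' k :=
  (⟨fun x => P.compContinuousAlternatingMap (α.1 x), fun e he =>
    (ContinuousLinearMap.compContinuousAlternatingMapCLM ℝ E 𝕜 𝕜' (Fin k) P).contDiff.comp_contDiffOn
      (α.2 e he)⟩ : smoothForms E M 𝕜' k)

theorem inChart_mapCoeff (P : 𝕜 →L[ℝ] 𝕜') {k : ℕ} (α : Form E M 𝕜 k)
    (e : OpenPartialHomeomorph M E) (z : E) :
    inChart e (mapCoeff P α).1 z = P.compContinuousAlternatingMap (inChart e α.1 z) := rfl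

theorem mapCoeff_d [IsManifold 𝓘(ℝ, E) ∞ M] (P : 𝕜 →L[ℝ] 𝕜') {k : ℕ} (α : Form E M 𝕜 k) :
    mapCoeff P (d E M 𝕜 k α) = d E M 𝕜' k (mapCoeff P α) := by
  refine Subtype.ext (ext_inChart fun e he z hz => ?_)
  rw [inChart_d _ he hz, inChart_mapCoeff, inChart_d _ he hz]
  have h : fderiv ℝ (inChart e (mapCoeff P α).1) z =
      (ContinuousLinearMap.compContinuousAlternatingMapCLM ℝ E 𝕜 𝕜' (Fin k) P).comp
        (fderiv ℝ (inChart e α.1) z) :=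
    ((ContinuousLinearMap.compContinuousAlternatingMapCLM ℝ E 𝕜 𝕜' (Fin k) P).hasFDerivAt.comp z
      (differentiableAt_inChart α he hz).hasFDerivAt).fderiv
  rw [extDeriv, extDeriv, h]
  ext v
  simp only [ContinuousLinearMap.compContinuousAlternatingMap_coe, Function.comp_apply,
    ContinuousAlternatingMap.alternatizeUncurryFin_apply, map_sum, map_zsmul]
  rfl

/-- A real form, as a complex form. -/
noncomputable abbrev complexify {k : ℕ} (α : Form E M ℝ k) : Form E M ℂ k :=
  mapCoeff Complex.ofRealCLM α

/-- The real part of a complex form. -/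
noncomputable abbrev realPart {k : ℕ} (α : Form E M ℂ k) : Form E M ℝ k :=
  mapCoeff Complex.reCLM α

theorem complexify_zero {k : ℕ} : complexify (0 : Form E M ℝ k) = 0 :=
  Subtype.ext (funext fun _ => ContinuousAlternatingMap.ext fun _ => Complex.ofReal_zero)

end Coefficients

section Complex

variable {E : Type u} [NormedAddCommGroup E] [NormedSpace ℂ E]
variable {X : Type v} [TopologicalSpace X] [ChartedSpace E X]

/-- The value of a form at a point `x` on given tangent vectors, as a linear map. -/
noncomputable def evalAt {k : ℕ} (x : X) (v : Fin k → E) : Form E X ℂ k →ₗ[ℂ] ℂ where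
  toFun α := (α.1 x : E [⋀^Fin k]→L[ℝ] ℂ) v
  map_add' _ _ := rfl
  map_smul' _ _ := rfl

theorem form_ext {k : ℕ} {α β : Form E X ℂ k}
    (h : ∀ (x : X) (v : Fin k → E), evalAt x v α = evalAt x v β) : α = β :=
  Subtype.ext (funext fun x => ContinuousAlternatingMap.ext fun v => h x v)

theorem evalAt_smul_mem {k : ℕ} (x : X) (v : Fin k → E) (α : Form E X ℂ k) :
    (fun c : ℂ => evalAt x (fun i => c • v i) α) ∈ Bihomogeneous.space k :=
  Bihomogeneous.multilinear_smul_mem (E := E)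
    (α.1 x : E [⋀^Fin k]→L[ℝ] ℂ).toMultilinearMap v

variable [IsManifold 𝓘(ℂ, E) ω X]

theorem mapCoeff_dc {𝕜 𝕜' : Type} [NormedField 𝕜] [NormedAlgebra ℝ 𝕜] [NormedField 𝕜']
    [NormedAlgebra ℝ 𝕜'] (P : 𝕜 →L[ℝ] 𝕜') {k : ℕ} (α : Form E X 𝕜 k) :
    mapCoeff P (dc E X 𝕜 k α) = dc E X 𝕜' k (mapCoeff P α) :=
  congrArg (Jinv E X 𝕜' (k + 1)) (mapCoeff_d P (J E X 𝕜 k α))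

/-! ### The decomposition of forms into types -/

open Finset Bihomogeneous

/-- The projection of complex forms of degree `k = p + q` to their component of type `(p, q)`. -/
noncomputable def typeProj (k p q : ℕ) : Form E X ℂ k →ₗ[ℂ] Form E X ℂ k :=
  ((2 * k + 1 : ℕ) : ℂ)⁻¹ • ∑ j ∈ range (2 * k + 1),
    (starRingEnd ℂ (root k ^ j) ^ p * (root k ^ j) ^ q) • pullC E X ℂ k (root k ^ j)

theorem evalAt_pullC {k : ℕ} (x : X) (v : Fin k → E) (c : ℂ) (α : Form E X ℂ k) :
    evalAt x v (pullC E X ℂ k c α) = evalAt x (fun i => c • v i) α := rfl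

theorem evalAt_typeProj {k p q : ℕ} (x : X) (v : Fin k → E) (α : Form E X ℂ k) :
    evalAt x v (typeProj k p q α) = coeff k p q fun c => evalAt x (fun i => c • v i) α := by
  simp only [typeProj, coeff_apply, LinearMap.smul_apply, LinearMap.sum_apply, map_smul, map_sum,
    evalAt_pullC]

/-- A complex form is the sum of its components: take `c = 1` in the expansion of
`α(c v₁, …, c vₖ)` into monomials in `c` and its conjugate. -/
theorem sum_typeProj {k : ℕ} (α : Form E X ℂ k) :
    ∑ pq ∈ antidiagonal k, typeProj k pq.1 pq.2 α = α := by
  refine form_ext fun x v => ?_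
  have h := eq_sum_coeff (evalAt_smul_mem x v α) 1
  simp only [one_smul, map_one, one_pow, mul_one] at h
  rw [map_sum, h]
  exact sum_congr rfl fun pq _ => evalAt_typeProj x v α

theorem typeProj_mem {k p q : ℕ} (h : p + q = k) (α : Form E X ℂ k) :
    typeProj k p q α ∈ typeForm E X p q k := fun c => by
  refine form_ext fun x v => ?_
  rw [evalAt_pullC, evalAt_typeProj, map_smul, evalAt_typeProj, smul_eq_mul,
    ← coeff_comp_mul h (evalAt_smul_mem x v α)]
  congr 1
  funext a
  simp only [smul_smul, mul_comm a c]

theorem typeProj_of_mem {k p q p' q' : ℕ} (h : p + q = k) (h' : p' + q' = k) {α : Form E X ℂ k}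
    (hα : α ∈ typeForm E X p' q' k) : typeProj k p q α = if p = p' then α else 0 := by
  have h1 : typeProj k p q α = coeff k p q (fun c => c ^ p' * starRingEnd ℂ c ^ q') • α := by
    refine form_ext fun x v => ?_
    have : (fun c : ℂ => evalAt x (fun i => c • v i) α) =
        evalAt x v α • fun c => c ^ p' * starRingEnd ℂ c ^ q' := by
      funext c
      rw [← evalAt_pullC, hα c, map_smul, Pi.smul_apply, smul_eq_mul, smul_eq_mul, mul_comm]
    rw [evalAt_typeProj, this, map_smul, map_smul, smul_eq_mul, smul_eq_mul, mul_comm]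
  rw [h1, coeff_monomial h h']
  split_ifs <;> simp

theorem typeProj_del {k p q : ℕ} (h : p + q = k) (α : Form E X ℂ k) :
    typeProj (k + 1) (p + 1) q (del E X k α) = del E X k (typeProj k p q α) := by
  conv_lhs => rw [← sum_typeProj α]
  rw [map_sum, map_sum, sum_eq_single (p, q)]
  · rw [typeProj_of_mem (by omega) (by omega) (del_mem (typeProj_mem h α)), if_pos rfl]
  · intro pq hpq hne
    have hpq := mem_antidiagonal.1 hpq
    rw [typeProj_of_mem (by omega) (by omega) (del_mem (typeProj_mem hpq α)), if_neg]
    intro h1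
    exact hne (Prod.ext (by simp only; omega) (by simp only; omega))
  · intro h1
    exact absurd (mem_antidiagonal.2 h) h1

theorem typeProj_delbar {k p q : ℕ} (h : p + q = k) (α : Form E X ℂ k) :
    typeProj (k + 1) p (q + 1) (delbar E X k α) = delbar E X k (typeProj k p q α) := by
  conv_lhs => rw [← sum_typeProj α]
  rw [map_sum, map_sum, sum_eq_single (p, q)]
  · rw [typeProj_of_mem (by omega) (by omega) (delbar_mem (typeProj_mem h α)), if_pos rfl]
  · intro pq hpq hne
    have hpq := mem_antidiagonal.1 hpq
    rw [typeProj_of_mem (by omega) (by omega) (delbar_mem (typeProj_mem hpq α)), if_neg]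
    intro h1
    exact hne (Prod.ext (by simp only; omega) (by simp only; omega))
  · intro h1
    exact absurd (mem_antidiagonal.2 h) h1

theorem typeProj_del_mem {k p q : ℕ} (h : p + q = k + 1) (α : Form E X ℂ k) :
    typeProj (k + 1) p q (del E X k α) ∈ imDel E X p q (k + 1) := by
  rw [← sum_typeProj α, map_sum, map_sum]
  refine sum_mem fun pq hpq => ?_
  have hpq := mem_antidiagonal.1 hpq
  have hm := typeProj_mem hpq α
  rw [typeProj_of_mem h (by omega) (del_mem hm)]
  split_ifs with hp
  · obtain rfl : q = pq.2 := by omega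
    subst hp
    exact ⟨_, hm, rfl⟩
  · exact zero_mem _

theorem typeProj_delbar_mem {k p q : ℕ} (h : p + q = k + 1) (α : Form E X ℂ k) :
    typeProj (k + 1) p q (delbar E X k α) ∈ imDelbar E X p q (k + 1) := by
  rw [← sum_typeProj α, map_sum, map_sum]
  refine sum_mem fun pq hpq => ?_
  have hpq := mem_antidiagonal.1 hpq
  have hm := typeProj_mem hpq α
  rw [typeProj_of_mem h (by omega) (delbar_mem hm)]
  split_ifs with hp
  · subst hp
    obtain rfl : q = pq.2 + 1 := by omega
    exact ⟨_, hm, rfl⟩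
  · exact zero_mem _

/-! ### The `∂∂̄`-Lemma and the `dd^c`-Lemma -/

theorem DelDelbarLemma.mem_imDelDelbar (hX : DelDelbarLemma E X) {p q k : ℕ} (h : p + q = k)
    {α : Form E X ℂ k} (hα : α ∈ bottChernCocycles E X p q k)
    (hα' : α ∈ imDel E X p q k ⊔ imDelbar E X p q k) : α ∈ imDelDelbar E X p q k := by
  have h1 := (injective_iff_map_eq_zero _).1 (hX p q k h) (Submodule.Quotient.mk ⟨α, hα⟩)
    ((Submodule.Quotient.mk_eq_zero _).2 hα')
  exact (Submodule.Quotient.mk_eq_zero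
    ((imDelDelbar E X p q k).comap (bottChernCocycles E X p q k).subtype)).1 h1

/-- The `∂∂̄`-Lemma for forms of mixed type: it applies to each component, because `∂` and `∂̄`
are compatible with the decomposition into types. -/
theorem DelDelbarLemma.typeProj_mem_imDelDelbar (hX : DelDelbarLemma E X) {k : ℕ}
    {α : Form E X ℂ (k + 1)} (h1 : del E X (k + 1) α = 0) (h2 : delbar E X (k + 1) α = 0)
    {β γ : Form E X ℂ k} (h3 : α = del E X k β + delbar E X k γ) {p q : ℕ} (h : p + q = k + 1) :
    typeProj (k + 1) p q α ∈ imDelDelbar E X p q (k + 1) := by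
  refine hX.mem_imDelDelbar h ⟨typeProj_mem h α, ?_, ?_⟩ ?_
  · refine LinearMap.mem_ker.2 ?_
    rw [← typeProj_del h, h1, map_zero]
  · refine LinearMap.mem_ker.2 ?_
    rw [← typeProj_delbar h, h2, map_zero]
  · rw [h3, map_add]
    exact Submodule.add_mem_sup (typeProj_del_mem h β) (typeProj_delbar_mem h γ)

/-- There are no forms of negative degree, so `∂∂̄` has no image in degree one. -/
theorem imDelDelbar_one (p q : ℕ) : imDelDelbar E X p q 1 = ⊥ := by
  rcases p with _ | p
  · rfl
  rcases q with _ | q <;> rfl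

theorem imDelDelbar_le_range (p q k : ℕ) :
    imDelDelbar E X p q (k + 2) ≤ LinearMap.range (del E X (k + 1) ∘ₗ delbar E X k) := by
  rcases p with _ | p
  · exact bot_le
  rcases q with _ | q
  · exact bot_le
  exact LinearMap.map_le_range

/-- `∂∂̄ = -(i / 2) d d^c`. -/
theorem del_delbar {k : ℕ} (α : Form E X ℂ k) :
    del E X (k + 1) (delbar E X k α) =
      d E X ℂ (k + 1) (dc E X ℂ k ((-Complex.I / 2) • α)) := by
  simp only [del, delbar, LinearMap.smul_apply, LinearMap.add_apply, LinearMap.sub_apply, map_smul,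
    map_sub, d_d, dc_dc, dc_d]
  module

/-- The condition on a real form for the `dd^c`-Lemma to apply to it: it is `d`-closed,
`d^c`-closed, and over the complex numbers it lies in `im ∂ + im ∂̄ = im d + im d^c`. -/
structure IsDDcCandidate {k : ℕ} (α : Form E X ℝ (k + 1)) : Prop where
  d_eq_zero : d E X ℝ (k + 1) α = 0
  dc_eq_zero : dc E X ℝ (k + 1) α = 0
  exists_eq : ∃ β γ : Form E X ℂ k, complexify α = del E X k β + delbar E X k γ

namespace IsDDcCandidate

theorem of_d {k : ℕ} {α : Form E X ℝ k} (h : dc E X ℝ (k + 1) (d E X ℝ k α) = 0) :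
    IsDDcCandidate (d E X ℝ k α) :=
  ⟨d_d k α, h, complexify α, complexify α, by
    rw [del_add_delbar]
    exact mapCoeff_d _ α⟩

theorem of_dc {k : ℕ} {α : Form E X ℝ k} (h : d E X ℝ (k + 1) (dc E X ℝ k α) = 0) :
    IsDDcCandidate (dc E X ℝ k α) := by
  refine ⟨h, dc_dc k α, -Complex.I • complexify α, Complex.I • complexify α, ?_⟩
  refine (mapCoeff_dc Complex.ofRealCLM α).trans ?_
  simp only [del, delbar, LinearMap.smul_apply, LinearMap.add_apply, LinearMap.sub_apply, map_smul]
  match_scalars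
  · linear_combination Complex.I_mul_I
  · ring

variable {k : ℕ}

theorem typeProj_mem (hX : DelDelbarLemma E X) {α : Form E X ℝ (k + 1)} (hα : IsDDcCandidate α)
    {p q : ℕ} (h : p + q = k + 1) :
    typeProj (k + 1) p q (complexify α) ∈ imDelDelbar E X p q (k + 1) := by
  obtain ⟨β, γ, hβγ⟩ := hα.exists_eq
  have h1 : d E X ℂ (k + 1) (complexify α) = 0 := by
    rw [complexify, ← mapCoeff_d, hα.d_eq_zero]
    exact complexify_zero
  have h2 : dc E X ℂ (k + 1) (complexify α) = 0 := by
    rw [complexify, ← mapCoeff_dc, hα.dc_eq_zero]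
    exact complexify_zero
  refine hX.typeProj_mem_imDelDelbar ?_ ?_ hβγ h
  · simp only [del, LinearMap.smul_apply, LinearMap.add_apply, h1, h2, smul_zero, add_zero]
  · simp only [delbar, LinearMap.smul_apply, LinearMap.sub_apply, h1, h2, smul_zero, sub_zero]

theorem eq_zero (hX : DelDelbarLemma E X) {α : Form E X ℝ 1} (hα : IsDDcCandidate α) : α = 0 := by
  have h : complexify α = 0 := by
    rw [← sum_typeProj (complexify α)]
    refine sum_eq_zero fun pq hpq => ?_
    have := hα.typeProj_mem hX (mem_antidiagonal.1 hpq)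
    exact (imDelDelbar_one (E := E) (X := X) pq.1 pq.2).le this
  exact congrArg realPart h

/-- Over the complex numbers `α = ∂∂̄η = d d^c (-(i / 2) η)`; as `d` and `d^c` are real operators, the
real part of `-(i / 2) η` will do. -/
theorem exists_eq_d_dc (hX : DelDelbarLemma E X) {α : Form E X ℝ (k + 2)}
    (hα : IsDDcCandidate α) : ∃ β : Form E X ℝ k, α = d E X ℝ (k + 1) (dc E X ℝ k β) := by
  have h : complexify α ∈ LinearMap.range (del E X (k + 1) ∘ₗ delbar E X k) := by
    rw [← sum_typeProj (complexify α)]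
    exact sum_mem fun pq hpq =>
      imDelDelbar_le_range _ _ _ (hα.typeProj_mem hX (mem_antidiagonal.1 hpq))
  obtain ⟨η, hη⟩ := h
  have hη : d E X ℂ (k + 1) (dc E X ℂ k ((-Complex.I / 2) • η)) = complexify α :=
    (del_delbar η).symm.trans hη
  refine ⟨realPart ((-Complex.I / 2) • η), ?_⟩
  rw [realPart, ← mapCoeff_dc, ← mapCoeff_d, hη]
  rfl

end IsDDcCandidate

/-- The `dd^c`-Lemma for real forms. -/
theorem DelDelbarLemma.ddLemma (hX : DelDelbarLemma E X) : (dcReal E X).DDLemma where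
  d_exact k (x : Form E X ℝ k) h := by
    have hx : IsDDcCandidate (d E X ℝ k x) := .of_d h
    cases k with
    | zero => exact ⟨0, zero_mem _, (hx.eq_zero hX).trans (map_zero _).symm⟩
    | succ k =>
      obtain ⟨β, hβ⟩ := hx.exists_eq_d_dc hX
      exact ⟨dc E X ℝ k β, ⟨β, rfl⟩, hβ⟩
  δ_exact k (x : Form E X ℝ k) h := by
    have hx : IsDDcCandidate (dc E X ℝ k x) := .of_dc h
    cases k with
    | zero => exact ⟨0, zero_mem _, (hx.eq_zero hX).trans (map_zero _).symm⟩
    | succ k =>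
      obtain ⟨β, hβ⟩ := hx.exists_eq_d_dc hX
      refine ⟨d E X ℝ k (-β), ⟨-β, rfl⟩, hβ.trans ?_⟩
      exact ((dc_d k (-β)).trans (by rw [map_neg, map_neg, neg_neg])).symm

end Complex

end DifferentialForms

theorem mainTheorem1 (E : Type u) [NormedAddCommGroup E] [NormedSpace ℂ E] [FiniteDimensional ℂ E]
    (X : Type v) [TopologicalSpace X] [ChartedSpace E X] [IsManifold 𝓘(ℂ, E) ω X] [T2Space X]
    [CompactSpace X] (hX : DifferentialForms.DelDelbarLemma E X) :
    -- the de Rham algebra of `X` is formal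
    (DifferentialForms.deRham E X).IsFormal ∧
    -- the inclusion `(ker d^c, d) → (Ω(X), d)` is a quasi-isomorphism
    (DifferentialForms.dcReal E X).incl.IsQuasiIso ∧
    -- the projection `(ker d^c, d) → (H_{d^c}(X), d)` is a quasi-isomorphism
    (DifferentialForms.dcReal E X).proj.IsQuasiIso ∧
    -- the differential induced by `d` on `H_{d^c}(X)` is zero
    ∀ k : ℕ, (DifferentialForms.dcReal E X).cohomology.d k = 0 :=
  ⟨hX.ddLemma.isFormal, hX.ddLemma.incl_isQuasiIso, hX.ddLemma.proj_isQuasiIso,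
    hX.ddLemma.cohomology_d⟩
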